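/- Let $d\ge 0$ be an integer, let $X=(X_1,\dots,X_d)\sim\mathcal N(0,I_{d\times d})$ be a standard Gaussian vector in $\mathbb R^d$, and let $F=f(X)$, where $f\in C^2(\mathbb R^d)$ is real-valued with $F\in L^2$, $E[F]=0$ and $E[F^2]=\sigma^2$ for some $\sigma>0$. Let $N\sim\mathcal N(0,\sigma^2)$. Write $\nabla_iF=\partial_if(X)$ and $\nabla^2_{ij}F=\partial_i\partial_jf(X)$. Then for each $M\in\{TV,Kol,W\}$ $$d_M(F,N)\le c_M\,\sqrt{\sum_{i,l=1}^d\Big\{E\Big[\Big(\sum_{j=1}^d\nabla^2_{ij}F\,\nabla^2_{lj}F\Big)^2\Big]\Big\}^{1/2}\Big\{E\big[(\nabla_iF\,\nabla_lF)^2\big]\Big\}^{1/2}},$$ with $$c_{TV}=\frac4{\sigma^2},\qquad c_{Kol}=\frac2{\sigma^2},\qquad c_W=\sqrt{\frac{8}{\sigma^2\pi}} .$$ Here the expectations on the right-hand side take values in $[0,\infty]$ (with $0\cdot\infty=0$), and for real random variables $U,V$, $d_{TV}(U,V)=\sup_{B}|P(U\in B)-P(V\in B)|$ (supremum over Borel sets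 $B\subseteq\mathbb R$), $d_{Kol}(U,V)=\sup_{z\in\mathbb R}|P(U\le z)-P(V\le z)|$, and $d_W(U,V)=\sup_h|E[h(U)]-E[h(V)]|$ (supremum over all $h:\mathbb R\to\mathbb R$ that are Lipschitz with constant at most $1$). -/

import Mathlib

open MeasureTheory ProbabilityTheory
open scoped ENNReal NNReal

namespace GaussianPoincare

noncomputable section

/-- Kolmogorov distance between the laws of two real random variables, possibly defined on
different probability spaces: `sup_z |P(X ≤ z) - P'(Y ≤ z)|`. -/
def dKol {Ω Ω' : Type*} [MeasurableSpace Ω] [MeasurableSpace Ω']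
    (P : Measure Ω) (P' : Measure Ω') (X : Ω → ℝ) (Y : Ω' → ℝ) : ℝ≥0∞ :=
  ⨆ z : ℝ, ENNReal.ofReal |P.real {ω | X ω ≤ z} - P'.real {ω | Y ω ≤ z}|

/-- Total variation distance: `sup_B |P(X ∈ B) - P'(Y ∈ B)|` over all Borel sets `B`. -/
def dTV {Ω Ω' : Type*} [MeasurableSpace Ω] [MeasurableSpace Ω']
    (P : Measure Ω) (P' : Measure Ω') (X : Ω → ℝ) (Y : Ω' → ℝ) : ℝ≥0∞ :=
  ⨆ (B : Set ℝ) (_ : MeasurableSet B),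
    ENNReal.ofReal |P.real {ω | X ω ∈ B} - P'.real {ω | Y ω ∈ B}|

/-- Wasserstein distance: `sup_h |E[h(X)] - E[h(Y)]|` over all `1`-Lipschitz `h : ℝ → ℝ`.
(It is meant for integrable `X` and `Y`, for which all these expectations exist.) -/
def dW {Ω Ω' : Type*} [MeasurableSpace Ω] [MeasurableSpace Ω']
    (P : Measure Ω) (P' : Measure Ω') (X : Ω → ℝ) (Y : Ω' → ℝ) : ℝ≥0∞ :=
  ⨆ (h : ℝ → ℝ) (_ : LipschitzWith 1 h),
    ENNReal.ofReal |∫ ω, h (X ω) ∂P - ∫ ω, h (Y ω) ∂P'|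

/-- The `i`-th partial derivative of `f : ℝ^d → ℝ`. -/
def partialDeriv {d : ℕ} (i : Fin d) (f : EuclideanSpace ℝ (Fin d) → ℝ) :
    EuclideanSpace ℝ (Fin d) → ℝ :=
  fun x => fderiv ℝ f x (EuclideanSpace.single i 1)

/-- The `ij`-th entry of the Hessian matrix of `f : ℝ^d → ℝ`. -/
def hessianEntry {d : ℕ} (i j : Fin d) (f : EuclideanSpace ℝ (Fin d) → ℝ) :
    EuclideanSpace ℝ (Fin d) → ℝ :=
  partialDeriv i (partialDeriv j f)

/-- The second order quantity, for `F = f(X)`,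
`√ (∑_{i,l} {E[(∑_j ∇²_{ij}F ∇²_{lj}F)²]}^{1/2} {E[(∇_i F ∇_l F)²]}^{1/2})`,
with expectations of nonnegative random variables taking values in `[0,∞]`. -/
def secondOrderQuantity {Ω : Type*} [MeasurableSpace Ω] (P : Measure Ω) {d : ℕ}
    (X : Ω → EuclideanSpace ℝ (Fin d)) (f : EuclideanSpace ℝ (Fin d) → ℝ) : ℝ≥0∞ :=
  (∑ i : Fin d, ∑ l : Fin d,
    (∫⁻ ω, ENNReal.ofReal
        ((∑ j : Fin d, hessianEntry i j f (X ω) * hessianEntry l j f (X ω)) ^ 2) ∂P) ^ (1 / 2 : ℝ)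
      * (∫⁻ ω, ENNReal.ofReal
        ((partialDeriv i f (X ω) * partialDeriv l f (X ω)) ^ 2) ∂P) ^ (1 / 2 : ℝ)) ^ (1 / 2 : ℝ)

end

end GaussianPoincare

namespace GaussianPoincare

open Real Set Filter Topology RealInnerProductSpace

set_option linter.unusedSectionVars false

section

/-! ### Gaussian integration by parts -/

/-! The proof combines Stein's method with a second order Poincaré inequality. Let `Y` be an
independent copy of `X`, and let `θ` be an independent angle with density `sin θ` on `(0, π/2]`.
Moving along the quarter circle from `X` to `Y` and integrating by parts gives the Mehler type
identity `Cov(u(X), f(X)) = E⟪∇u(X), ∇f(cos θ X + sin θ Y)⟫` (`covariance_stdGaussian`).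

Put `Z(x) = E⟪∇f(x), ∇f(cos θ x + sin θ Y)⟫`. Taking `u = f` gives `E[Z(X)] = σ²`, and `u = g ∘ f`
gives `E[F g(F)] = E[g'(F) Z(X)]`. Hence `|E[σ² g'(F) - F g(F)]| ≤ K √Var(Z(X))` whenever `|g'| ≤ K`
(`abs_integral_stein_le`).

The covariance identity also yields the Poincaré inequality. Applied for fixed `(θ, y)` and then
averaged, it bounds `Var(Z(X))` by the mean square of an `x`-gradient made of two
Hessian-times-gradient terms. Expanding these squares and using Cauchy–Schwarz separates Hessian
products from gradient products, since both points involved are standard Gaussian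
(`lintegral_hessian_gradient_le`). With `A` the sum under the root, `Var(Z(X)) ≤ 4A`, so the Stein
discrepancy is at most `2√A`.

It remains to solve `g'(x) - x g(x) = h(x) - E[h]` for the standard Gaussian law. The bound on `g'`
is `2` for continuous `h` with values in `[0, 1]`, `1` if `h` is also decreasing, and `L √(2/π)` if
`h` is smooth with `|h'| ≤ L`. Rescaling to variance `σ²` divides by `σ²`, with `L = σ` in the
Lipschitz case; the factor `2` of the discrepancy then produces the three constants. Indicators and
general Lipschitz functions are reached by approximation, which keeps every `g` of class `C¹`. -/

theorem integrable_gaussianReal_iff {v : ℝ → ℝ} :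
    Integrable v (gaussianReal 0 1) ↔ Integrable (fun x => gaussianPDFReal 0 1 x * v x) := by
  rw [gaussianReal_of_var_ne_zero _ one_ne_zero,
    integrable_withDensity_iff_integrable_smul' (measurable_gaussianPDF _ _)
      (ae_of_all _ fun _ ↦ gaussianPDF_lt_top)]
  simp

theorem hasDerivAt_gaussianPDFReal (x : ℝ) :
    HasDerivAt (gaussianPDFReal 0 1) (-(x * gaussianPDFReal 0 1 x)) x := by
  have h : gaussianPDFReal 0 1 = fun x : ℝ => (√(2 * π))⁻¹ * rexp (-x ^ 2 / 2) := by
    ext x; simp [gaussianPDFReal]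
  rw [h]
  have h1 : HasDerivAt (fun x : ℝ => -x ^ 2 / 2) (-x) x :=
    ((hasDerivAt_pow 2 x).neg.div_const 2).congr_deriv (by push_cast; ring)
  exact (h1.exp.const_mul (√(2 * π))⁻¹).congr_deriv (by ring)

/-- The density times `v` is integrable with integrable derivative, so that derivative has integral
zero; no separate decay hypothesis is needed. -/
theorem integral_mul_gaussianReal_eq_integral_deriv {v v' : ℝ → ℝ}
    (hv : ∀ x, HasDerivAt v (v' x) x)
    (h1 : Integrable v (gaussianReal 0 1)) (h2 : Integrable (fun x => x * v x) (gaussianReal 0 1))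
    (h3 : Integrable v' (gaussianReal 0 1)) :
    ∫ x, x * v x ∂(gaussianReal 0 1) = ∫ x, v' x ∂(gaussianReal 0 1) := by
  rw [integrable_gaussianReal_iff] at h1 h2 h3
  rw [integral_gaussianReal_eq_integral_smul one_ne_zero,
    integral_gaussianReal_eq_integral_smul one_ne_zero]
  simp only [smul_eq_mul]
  have hd : ∀ x, HasDerivAt (fun x => gaussianPDFReal 0 1 x * v x)
      (gaussianPDFReal 0 1 x * v' x - gaussianPDFReal 0 1 x * (x * v x)) x := fun x => by
    exact ((hasDerivAt_gaussianPDFReal x).mul (hv x)).congr_deriv (by ring)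
  have := integral_eq_zero_of_hasDerivAt_of_integrable hd (h3.sub h2) h1
  rw [integral_sub h3 h2] at this
  linarith

variable {E : Type*} [NormedAddCommGroup E] [InnerProductSpace ℝ E] [FiniteDimensional ℝ E]
  [MeasurableSpace E] [BorelSpace E]

/-- The standard Gaussian measure splits as the independent sum of its component along a unit
vector and of its orthogonal component. -/
theorem measurePreserving_stdGaussian_line {e : E} (he : ‖e‖ = 1) :
    MeasurePreserving (fun p : ℝ × E => p.1 • e + (p.2 - ⟪p.2, e⟫ • e))
      ((gaussianReal 0 1).prod (stdGaussian E)) (stdGaussian E) := by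
  have hm : Measurable (fun p : ℝ × E => p.1 • e + (p.2 - ⟪p.2, e⟫ • e)) := by fun_prop
  refine ⟨hm, ?_⟩
  have : IsProbabilityMeasure (((gaussianReal 0 1).prod (stdGaussian E)).map
      (fun p : ℝ × E => p.1 • e + (p.2 - ⟪p.2, e⟫ • e))) :=
    Measure.isProbabilityMeasure_map hm.aemeasurable
  -- The two factors of the characteristic function have exponents `-⟪e, t⟫² / 2` and `-‖t - ⟪e, t⟫
  -- • e‖² / 2`, which add up to `-‖t‖² / 2` by Pythagoras since `e` is a unit vector.
  refine Measure.ext_of_charFun ?_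
  ext t
  rw [charFun_stdGaussian, charFun_apply, integral_map hm.aemeasurable (by fun_prop)]
  have h1 : ∀ p : ℝ × E, Complex.exp (⟪p.1 • e + (p.2 - ⟪p.2, e⟫ • e), t⟫ * Complex.I)
      = Complex.exp ((⟪e, t⟫ : ℝ) * p.1 * Complex.I)
        * Complex.exp (⟪p.2, t - ⟪e, t⟫ • e⟫ * Complex.I) := fun p => by
    rw [← Complex.exp_add, ← add_mul, ← Complex.ofReal_mul, ← Complex.ofReal_add]
    congr 3
    simp only [inner_add_left, inner_sub_left, inner_sub_right, real_inner_smul_left,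
      real_inner_smul_right]
    ring
  simp_rw [h1]
  rw [integral_prod_mul (fun r : ℝ => Complex.exp ((⟪e, t⟫ : ℝ) * r * Complex.I))
    (fun y : E => Complex.exp (⟪y, t - ⟪e, t⟫ • e⟫ * Complex.I)), ← charFun_apply_real,
    ← charFun_apply, charFun_gaussianReal, charFun_stdGaussian, ← Complex.exp_add]
  congr 1
  have h2 : ‖t - ⟪e, t⟫ • e‖ ^ 2 = ‖t‖ ^ 2 - ⟪e, t⟫ ^ 2 := by
    rw [norm_sub_sq_real, norm_smul, he, real_inner_smul_right, real_inner_comm e t]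
    simp
    ring
  have h3 : (‖t - ⟪e, t⟫ • e‖ : ℂ) ^ 2 = ‖t‖ ^ 2 - ⟪e, t⟫ ^ 2 := by exact_mod_cast h2
  rw [h3]
  push_cast
  simp
  ring

/-- Freezing the component orthogonal to `e` leaves the one-dimensional formula on a line; Fubini
supplies its integrability hypotheses on almost every line. -/
theorem integral_mul_inner_stdGaussian_of_norm_eq_one {v : E → ℝ} (hv : ContDiff ℝ 1 v) {e : E}
    (he : ‖e‖ = 1) (h1 : Integrable v (stdGaussian E))
    (h2 : Integrable (fun x => v x * ⟪x, e⟫) (stdGaussian E))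
    (h3 : Integrable (fun x => fderiv ℝ v x e) (stdGaussian E)) :
    ∫ x, v x * ⟪x, e⟫ ∂(stdGaussian E) = ∫ x, fderiv ℝ v x e ∂(stdGaussian E) := by
  have hmp := measurePreserving_stdGaussian_line he
  have hin : ∀ p : ℝ × E, ⟪p.1 • e + (p.2 - ⟪p.2, e⟫ • e), e⟫ = p.1 := fun p => by
    simp [inner_add_left, inner_sub_left, real_inner_smul_left, he]
  have g1 := hmp.integrable_comp_of_integrable h1
  have g2 := hmp.integrable_comp_of_integrable h2
  have g3 := hmp.integrable_comp_of_integrable h3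
  have e2 : ∫ x, v x * ⟪x, e⟫ ∂(stdGaussian E)
      = ∫ p : ℝ × E, v (p.1 • e + (p.2 - ⟪p.2, e⟫ • e)) * p.1
        ∂((gaussianReal 0 1).prod (stdGaussian E)) := by
    rw [← hmp.hasLaw.integral_comp h2.aestronglyMeasurable]
    simp only [Function.comp_def, hin]
  have e3 : ∫ x, fderiv ℝ v x e ∂(stdGaussian E)
      = ∫ p : ℝ × E, fderiv ℝ v (p.1 • e + (p.2 - ⟪p.2, e⟫ • e)) e
        ∂((gaussianReal 0 1).prod (stdGaussian E)) := by
    rw [← hmp.hasLaw.integral_comp h3.aestronglyMeasurable]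
    simp only [Function.comp_def]
  have g2' : Integrable (fun p : ℝ × E => v (p.1 • e + (p.2 - ⟪p.2, e⟫ • e)) * p.1)
      ((gaussianReal 0 1).prod (stdGaussian E)) := by
    refine g2.congr (ae_of_all _ fun p => ?_)
    simp only [Function.comp, hin]
  simp only [Function.comp_def] at g3
  rw [e2, e3, integral_prod_symm _ g2', integral_prod_symm _ g3]
  refine integral_congr_ae ?_
  filter_upwards [g1.prod_left_ae, g2'.prod_left_ae, g3.prod_left_ae] with y k1 k2 k3
  have hd : ∀ r : ℝ, HasDerivAt (fun r : ℝ => v (r • e + (y - ⟪y, e⟫ • e)))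
      (fderiv ℝ v (r • e + (y - ⟪y, e⟫ • e)) e) r := fun r => by
    have : HasDerivAt (fun r : ℝ => r • e + (y - ⟪y, e⟫ • e)) e r := by
      simpa using ((hasDerivAt_id r).smul_const e).add_const (y - ⟪y, e⟫ • e)
    exact ((hv.differentiable one_ne_zero _).hasFDerivAt).comp_hasDerivAt r this
  simp only [mul_comm _ (_ : ℝ)] at k2 ⊢
  exact integral_mul_gaussianReal_eq_integral_deriv hd k1 k2 k3

/-- Gaussian integration by parts. -/
theorem integral_mul_inner_stdGaussian {v : E → ℝ} (hv : ContDiff ℝ 1 v) (e : E)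
    (h1 : Integrable v (stdGaussian E))
    (h2 : Integrable (fun x => v x * ⟪x, e⟫) (stdGaussian E))
    (h3 : Integrable (fun x => fderiv ℝ v x e) (stdGaussian E)) :
    ∫ x, v x * ⟪x, e⟫ ∂(stdGaussian E) = ∫ x, fderiv ℝ v x e ∂(stdGaussian E) := by
  rcases eq_or_ne e 0 with rfl | he
  · simp
  have hn : ‖e‖ ≠ 0 := norm_ne_zero_iff.2 he
  obtain ⟨c, e', hc, he', rfl⟩ : ∃ (c : ℝ) (e' : E), c ≠ 0 ∧ ‖e'‖ = 1 ∧ e = c • e' :=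
    ⟨‖e‖, ‖e‖⁻¹ • e, hn, by simp [norm_smul, hn], by rw [smul_smul, mul_inv_cancel₀ hn, one_smul]⟩
  simp only [real_inner_smul_right, map_smul, smul_eq_mul, mul_left_comm _ c] at h2 h3 ⊢
  rw [integral_const_mul, integral_const_mul,
    integral_mul_inner_stdGaussian_of_norm_eq_one hv he' h1]
  · exact (integrable_const_mul_iff hc.isUnit _).1 h2
  · exact (integrable_const_mul_iff hc.isUnit _).1 h3

end

section

/-! ### Rotations of pairs of independent Gaussian vectors -/

variable {E : Type*} [NormedAddCommGroup E] [InnerProductSpace ℝ E] [FiniteDimensional ℝ E]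
  [MeasurableSpace E] [BorelSpace E]

theorem measurePreserving_rotation (θ : ℝ) :
    MeasurePreserving (ContinuousLinearMap.rotation θ : E × E → E × E)
      ((stdGaussian E).prod (stdGaussian E)) ((stdGaussian E).prod (stdGaussian E)) :=
  ⟨(ContinuousLinearMap.rotation θ).continuous.measurable,
    IsGaussian.map_rotation_eq_self (by simp) θ⟩

theorem rotation_neg_rotation (θ : ℝ) (p : E × E) :
    ContinuousLinearMap.rotation (-θ) (ContinuousLinearMap.rotation θ p) = p := by
  have h := Real.sin_sq_add_cos_sq θ
  simp only [ContinuousLinearMap.rotation_apply, Real.cos_neg, Real.sin_neg]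
  refine Prod.ext ?_ ?_
  · calc Real.cos θ • (Real.cos θ • p.1 + Real.sin θ • p.2)
          + (-Real.sin θ) • ((-Real.sin θ) • p.1 + Real.cos θ • p.2)
        = (Real.sin θ ^ 2 + Real.cos θ ^ 2) • p.1 := by module
      _ = p.1 := by rw [h, one_smul]
  · calc (-(-Real.sin θ)) • (Real.cos θ • p.1 + Real.sin θ • p.2)
          + Real.cos θ • ((-Real.sin θ) • p.1 + Real.cos θ • p.2)
        = (Real.sin θ ^ 2 + Real.cos θ ^ 2) • p.2 := by module
      _ = p.2 := by rw [h, one_smul]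

/-- The measure on angles is kept general because Lebesgue measure on `(0, π/2]` and `angleMeasure`
both occur below. -/
theorem measurePreserving_skew_rotation (μ : Measure ℝ) [SFinite μ] :
    MeasurePreserving (fun q : ℝ × (E × E) => (q.1, ContinuousLinearMap.rotation q.1 q.2))
      (μ.prod ((stdGaussian E).prod (stdGaussian E)))
      (μ.prod ((stdGaussian E).prod (stdGaussian E))) := by
  refine (MeasurePreserving.id μ).skew_product
    (g := fun θ p => ContinuousLinearMap.rotation θ p) ?_
    (ae_of_all _ fun θ => (measurePreserving_rotation θ).map_eq)
  have : Continuous (Function.uncurry fun (θ : ℝ) (p : E × E) =>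
      ContinuousLinearMap.rotation θ p) := by
    simp only [ContinuousLinearMap.rotation_apply, Function.uncurry_def]
    fun_prop
  exact this.measurable

/-! ### The random angle and the Mehler interpolation. -/

/-- The probability measure `sin θ dθ` on `(0, π / 2]`. -/
noncomputable def angleMeasure : Measure ℝ :=
  (volume.restrict (Ioc 0 (π / 2))).withDensity fun θ => ENNReal.ofReal (Real.sin θ)

theorem sin_nonneg_of_mem_Ioc {θ : ℝ} (h : θ ∈ Ioc 0 (π / 2)) : 0 ≤ Real.sin θ :=
  Real.sin_nonneg_of_nonneg_of_le_pi h.1.le (by linarith [h.2, Real.pi_pos])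

instance isProbabilityMeasure_angleMeasure : IsProbabilityMeasure angleMeasure := by
  refine ⟨?_⟩
  rw [angleMeasure, withDensity_apply _ MeasurableSet.univ, Measure.restrict_univ,
    ← ofReal_integral_eq_lintegral_ofReal]
  · rw [← intervalIntegral.integral_of_le (by positivity), integral_sin]
    simp
  · exact (continuous_sin.integrableOn_Icc (a := 0) (b := π / 2)).mono_set Ioc_subset_Icc_self
  · filter_upwards [ae_restrict_mem measurableSet_Ioc] with θ hθ using sin_nonneg_of_mem_Ioc hθ

theorem integral_angleMeasure (g : ℝ → ℝ) :
    ∫ θ, g θ ∂angleMeasure = ∫ θ in Ioc 0 (π / 2), Real.sin θ * g θ := by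
  rw [angleMeasure, integral_withDensity_eq_integral_toReal_smul (by fun_prop)
    (ae_of_all _ fun _ => ENNReal.ofReal_lt_top)]
  refine setIntegral_congr_fun measurableSet_Ioc fun θ hθ => ?_
  simp [ENNReal.toReal_ofReal (sin_nonneg_of_mem_Ioc hθ)]

/-- The law of the pair (random angle, independent standard Gaussian vector). -/
noncomputable def mehlerLaw (E : Type*) [NormedAddCommGroup E] [InnerProductSpace ℝ E]
    [FiniteDimensional ℝ E] [MeasurableSpace E] : Measure (ℝ × E) :=
  angleMeasure.prod (stdGaussian E)

instance isProbabilityMeasure_mehlerLaw : IsProbabilityMeasure (mehlerLaw E) := by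
  unfold mehlerLaw; infer_instance

/-- The interpolation `(x, θ, y) ↦ cos θ • x + sin θ • y`. -/
noncomputable def mehler (p : E × (ℝ × E)) : E := Real.cos p.2.1 • p.1 + Real.sin p.2.1 • p.2.2

theorem continuous_mehler : Continuous (mehler : E × (ℝ × E) → E) := by
  unfold mehler; fun_prop

theorem measurePreserving_reorder (μ : Measure ℝ) [SFinite μ] :
    MeasurePreserving (fun q : ℝ × (E × E) => (q.2.1, (q.1, q.2.2)))
      (μ.prod ((stdGaussian E).prod (stdGaussian E)))
      ((stdGaussian E).prod (μ.prod (stdGaussian E))) := by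
  have h1 := (measurePreserving_prodAssoc μ (stdGaussian E) (stdGaussian E)).symm
  have h2 := (Measure.measurePreserving_swap (μ := μ) (ν := stdGaussian E)).prod
    (MeasurePreserving.id (stdGaussian E))
  have h3 := measurePreserving_prodAssoc (stdGaussian E) μ (stdGaussian E)
  exact (h3.comp h2).comp h1

/-- At every angle the interpolation is the first coordinate of a rotated Gaussian pair, so its law
does not depend on the angle. -/
theorem measurePreserving_mehler :
    MeasurePreserving mehler ((stdGaussian E).prod (mehlerLaw E)) (stdGaussian E) := by
  have h1 := measurePreserving_reorder (E := E) angleMeasure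
  have h2 := measurePreserving_fst.comp (measurePreserving_snd.comp
    (measurePreserving_skew_rotation (E := E) angleMeasure))
  refine ⟨continuous_mehler.measurable, ?_⟩
  rw [mehlerLaw, ← h1.map_eq, Measure.map_map continuous_mehler.measurable h1.measurable]
  exact h2.map_eq

/-! ### Covariance identity and Poincaré inequality -/

theorem continuous_gradient {u : E → ℝ} (hu : ContDiff ℝ 1 u) : Continuous (gradient u) :=
  (InnerProductSpace.toDual ℝ E).symm.continuous.comp (hu.continuous_fderiv one_ne_zero)

theorem integrable_norm_mul_norm_prod {w : E → E} (hw : MemLp w 2 (stdGaussian E)) :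
    Integrable (fun p : E × E => ‖w p.1‖ ^ 2 * ‖p.2‖ ^ 2)
      ((stdGaussian E).prod (stdGaussian E)) :=
  (hw.integrable_norm_pow two_ne_zero).mul_prod
    ((IsGaussian.memLp_two_id (μ := stdGaussian E)).integrable_norm_pow two_ne_zero)

/-- Only serves to provide integrable majorants, so the constant is immaterial. -/
theorem norm_inner_le_add_sq (b c : E) : ‖(⟪b, c⟫ : ℝ)‖ ≤ ‖b‖ ^ 2 + ‖c‖ ^ 2 := by
  refine (norm_inner_le_norm _ _).trans ?_
  nlinarith [two_mul_le_add_sq ‖b‖ ‖c‖, sq_nonneg ‖b‖, sq_nonneg ‖c‖]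

theorem norm_mul_inner_le (a : ℝ) (b c : E) :
    ‖a * ⟪b, c⟫‖ ≤ ‖a‖ ^ 2 + ‖b‖ ^ 2 * ‖c‖ ^ 2 := by
  have h := norm_inner_le_norm (𝕜 := ℝ) b c
  rw [norm_mul]
  nlinarith [sq_nonneg (‖a‖ - ‖b‖ * ‖c‖), norm_nonneg a, norm_nonneg b, norm_nonneg c,
    mul_le_mul_of_nonneg_left h (norm_nonneg a), sq_nonneg (‖a‖), sq_nonneg (‖b‖ * ‖c‖)]

/-- Gaussian integration by parts in the second variable of a rotated pair. -/
theorem integral_rotation_mul_inner {u : E → ℝ} {w : E → E} (hu : ContDiff ℝ 1 u)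
    (hw : Continuous w) (hu2 : MemLp u 2 (stdGaussian E))
    (hu' : MemLp (gradient u) 2 (stdGaussian E)) (hw2 : MemLp w 2 (stdGaussian E)) (θ : ℝ) :
    ∫ p : E × E, u (ContinuousLinearMap.rotation θ p).1 * ⟪w p.1, p.2⟫
        ∂((stdGaussian E).prod (stdGaussian E))
      = ∫ p : E × E, Real.sin θ * ⟪gradient u (ContinuousLinearMap.rotation θ p).1, w p.1⟫
        ∂((stdGaussian E).prod (stdGaussian E)) := by
  have hr := measurePreserving_rotation (E := E) θ
  have hcr : Continuous fun p : E × E => (ContinuousLinearMap.rotation θ p).1 := by fun_prop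
  have hgu := continuous_gradient hu
  have hr1 : MeasurePreserving (fun p : E × E => (ContinuousLinearMap.rotation θ p).1)
      ((stdGaussian E).prod (stdGaussian E)) (stdGaussian E) := measurePreserving_fst.comp hr
  have k1 : Integrable (fun p : E × E => u (ContinuousLinearMap.rotation θ p).1)
      ((stdGaussian E).prod (stdGaussian E)) :=
    hr1.integrable_comp_of_integrable (hu2.integrable one_le_two)
  have k1' : Integrable (fun p : E × E => ‖u (ContinuousLinearMap.rotation θ p).1‖ ^ 2)
      ((stdGaussian E).prod (stdGaussian E)) :=
    hr1.integrable_comp_of_integrable (hu2.integrable_norm_pow two_ne_zero)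
  have k2 : Integrable (fun p : E × E => u (ContinuousLinearMap.rotation θ p).1 * ⟪w p.1, p.2⟫)
      ((stdGaussian E).prod (stdGaussian E)) := by
    refine (k1'.add (integrable_norm_mul_norm_prod hw2)).mono' ?_
      (ae_of_all _ fun p => norm_mul_inner_le _ _ _)
    exact ((hu.continuous.comp hcr).mul (by fun_prop)).aestronglyMeasurable
  have k3' : Integrable (fun p : E × E => ‖gradient u (ContinuousLinearMap.rotation θ p).1‖ ^ 2)
      ((stdGaussian E).prod (stdGaussian E)) :=
    hr1.integrable_comp_of_integrable (hu'.integrable_norm_pow two_ne_zero)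
  have k3 : Integrable (fun p : E × E => Real.sin θ *
      ⟪gradient u (ContinuousLinearMap.rotation θ p).1, w p.1⟫)
      ((stdGaussian E).prod (stdGaussian E)) := by
    refine Integrable.const_mul ?_ _
    exact (k3'.add ((hw2.integrable_norm_pow two_ne_zero).comp_fst (stdGaussian E))).mono'
      (Continuous.inner (hgu.comp hcr) (by fun_prop)).aestronglyMeasurable
      (ae_of_all _ fun p => norm_inner_le_add_sq _ _)
  rw [integral_prod _ k2, integral_prod _ k3]
  refine integral_congr_ae ?_
  -- With the first vector `a` frozen, integrate by parts in the second one along `w a`. The chain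
  -- rule produces the factor `sin θ` that becomes the density of the angle.
  filter_upwards [k1.prod_right_ae, k2.prod_right_ae, k3.prod_right_ae] with a i1 i2 i3
  simp only [ContinuousLinearMap.rotation_apply] at i1 i2 i3 ⊢
  have hfd : ∀ b, fderiv ℝ (fun b => u (Real.cos θ • a + Real.sin θ • b)) b (w a)
      = Real.sin θ * ⟪gradient u (Real.cos θ • a + Real.sin θ • b), w a⟫ := fun b => by
    have hb : HasFDerivAt (fun b : E => Real.cos θ • a + Real.sin θ • b)
        (Real.sin θ • ContinuousLinearMap.id ℝ E) b :=
      ((hasFDerivAt_id b).const_smul (Real.sin θ)).const_add _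
    have := ((hu.differentiable one_ne_zero (Real.cos θ • a + Real.sin θ • b)).hasFDerivAt).comp b hb
    rw [show (fun b => u (Real.cos θ • a + Real.sin θ • b))
      = u ∘ fun b => Real.cos θ • a + Real.sin θ • b from rfl, this.fderiv, inner_gradient_left]
    simp
  simp only [← hfd, real_inner_comm _ (w a)] at i3 ⊢
  simp only [real_inner_comm _ (w a)] at i2
  exact integral_mul_inner_stdGaussian
    (hu.comp (contDiff_const.add (contDiff_id.const_smul _))) (w a) i1 i2 i3

theorem continuous_skew_rotation :
    Continuous fun q : ℝ × (E × E) => ContinuousLinearMap.rotation q.1 q.2 := by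
  simp only [ContinuousLinearMap.rotation_apply]; fun_prop

theorem integrable_inner_mehler {v w : E → E} (hv : Continuous v) (hw : Continuous w)
    (hv2 : MemLp v 2 (stdGaussian E)) (hw2 : MemLp w 2 (stdGaussian E)) :
    Integrable (fun p => ⟪v p.1, w (mehler p)⟫) ((stdGaussian E).prod (mehlerLaw E)) := by
  have i1 : Integrable (fun p : E × (ℝ × E) => ‖v p.1‖ ^ 2)
      ((stdGaussian E).prod (mehlerLaw E)) :=
    (hv2.integrable_norm_pow two_ne_zero).comp_fst _
  have i2 : Integrable (fun p : E × (ℝ × E) => ‖w (mehler p)‖ ^ 2)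
      ((stdGaussian E).prod (mehlerLaw E)) :=
    measurePreserving_mehler.integrable_comp_of_integrable
      (hw2.integrable_norm_pow two_ne_zero)
  exact (i1.add i2).mono' ((hv.comp continuous_fst).inner
    (hw.comp continuous_mehler)).aestronglyMeasurable
    (ae_of_all _ fun p => norm_inner_le_add_sq _ _)

theorem integral_inner_mehler {v w : E → E} (hv : Continuous v) (hw : Continuous w)
    (hv2 : MemLp v 2 (stdGaussian E)) (hw2 : MemLp w 2 (stdGaussian E)) :
    ∫ p, ⟪v p.1, w (mehler p)⟫ ∂((stdGaussian E).prod (mehlerLaw E))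
      = ∫ θ in Ioc 0 (π / 2), Real.sin θ * ∫ p : E × E,
        ⟪v p.1, w (ContinuousLinearMap.rotation θ p).1⟫
          ∂((stdGaussian E).prod (stdGaussian E)) := by
  have h1 := measurePreserving_reorder (E := E) angleMeasure
  have hi := integrable_inner_mehler hv hw hv2 hw2
  rw [mehlerLaw] at hi ⊢
  rw [← h1.hasLaw.integral_comp hi.aestronglyMeasurable,
    integral_prod _ (h1.integrable_comp_of_integrable hi), integral_angleMeasure]
  rfl

/-- Fundamental theorem of calculus along the quarter circle from `p.1` to `p.2`: the angular
derivative of the first rotated coordinate is the second one. -/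
theorem mul_sub_eq_neg_integral_rotation {f : E → ℝ} (hf : ContDiff ℝ 1 f) (a : ℝ) (p : E × E) :
    a * (f p.1 - f p.2) = -∫ θ in Ioc 0 (π / 2), a *
      ⟪gradient f (ContinuousLinearMap.rotation θ p).1,
        (ContinuousLinearMap.rotation θ p).2⟫ := by
  simp only [ContinuousLinearMap.rotation_apply]
  have hd : ∀ θ : ℝ, HasDerivAt (fun θ : ℝ => f (Real.cos θ • p.1 + Real.sin θ • p.2))
      ⟪gradient f (Real.cos θ • p.1 + Real.sin θ • p.2),
        -Real.sin θ • p.1 + Real.cos θ • p.2⟫ θ := fun θ => by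
    have h1 : HasDerivAt (fun θ : ℝ => Real.cos θ • p.1 + Real.sin θ • p.2)
        (-Real.sin θ • p.1 + Real.cos θ • p.2) θ :=
      ((Real.hasDerivAt_cos θ).smul_const p.1).add ((Real.hasDerivAt_sin θ).smul_const p.2)
    rw [inner_gradient_left]
    exact (hf.differentiable one_ne_zero _).hasFDerivAt.comp_hasDerivAt θ h1
  have hc : Continuous fun θ : ℝ => (⟪gradient f (Real.cos θ • p.1 + Real.sin θ • p.2),
      -Real.sin θ • p.1 + Real.cos θ • p.2⟫ : ℝ) :=
    ((continuous_gradient hf).comp (by fun_prop)).inner (by fun_prop)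
  have := intervalIntegral.integral_eq_sub_of_hasDerivAt (a := 0) (b := π / 2)
    (fun θ _ => hd θ) (hc.intervalIntegrable _ _)
  rw [integral_const_mul, ← intervalIntegral.integral_of_le (by positivity), this]
  simp
  ring

theorem integrable_mul_inner_rotation {u : E → ℝ} {w : E → E} (hu : Continuous u)
    (hw : Continuous w) (hu2 : MemLp u 2 (stdGaussian E)) (hw2 : MemLp w 2 (stdGaussian E)) :
    Integrable (Function.uncurry fun (p : E × E) (θ : ℝ) => u p.1 *
      ⟪w (ContinuousLinearMap.rotation θ p).1, (ContinuousLinearMap.rotation θ p).2⟫)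
      (((stdGaussian E).prod (stdGaussian E)).prod (volume.restrict (Ioc 0 (π / 2)))) := by
  have hcrot := continuous_skew_rotation (E := E)
  rw [← integrable_swap_iff]
  have i1 : Integrable (fun q : ℝ × (E × E) => ‖u q.2.1‖ ^ 2)
      ((volume.restrict (Ioc 0 (π / 2))).prod ((stdGaussian E).prod (stdGaussian E))) :=
    ((hu2.integrable_norm_pow two_ne_zero).comp_fst (stdGaussian E)).comp_snd _
  have i2 : Integrable (fun q : ℝ × (E × E) =>
      ‖w (ContinuousLinearMap.rotation q.1 q.2).1‖ ^ 2
        * ‖(ContinuousLinearMap.rotation q.1 q.2).2‖ ^ 2)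
      ((volume.restrict (Ioc 0 (π / 2))).prod ((stdGaussian E).prod (stdGaussian E))) :=
    (measurePreserving_skew_rotation (E := E) _).integrable_comp_of_integrable
      ((integrable_norm_mul_norm_prod hw2).comp_snd _)
  refine (i1.add i2).mono' ?_ (ae_of_all _ fun q => norm_mul_inner_le _ _ _)
  exact ((hu.comp (by fun_prop)).mul ((hw.comp (continuous_fst.comp hcrot)).inner
    (continuous_snd.comp hcrot))).aestronglyMeasurable

/-- Covariance identity: the covariance of `u(X)` and `f(X)` is the expectation of
`⟪∇u(X), ∇f(cos θ X + sin θ Y)⟫`. -/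
theorem covariance_stdGaussian {u f : E → ℝ} (hu : ContDiff ℝ 1 u) (hf : ContDiff ℝ 1 f)
    (hu2 : MemLp u 2 (stdGaussian E)) (hf2 : MemLp f 2 (stdGaussian E))
    (hu' : MemLp (gradient u) 2 (stdGaussian E)) (hf' : MemLp (gradient f) 2 (stdGaussian E)) :
    ∫ x, u x * f x ∂(stdGaussian E) - (∫ x, u x ∂(stdGaussian E)) * ∫ x, f x ∂(stdGaussian E)
      = ∫ p, ⟪gradient u p.1, gradient f (mehler p)⟫ ∂((stdGaussian E).prod (mehlerLaw E)) := by
  have hgu := continuous_gradient hu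
  have hgf := continuous_gradient hf
  have hu1 := hu2.integrable one_le_two
  have hf1 := hf2.integrable one_le_two
  have huf : Integrable (fun x => u x * f x) (stdGaussian E) := hu2.integrable_mul hf2
  have hL : ∫ x, u x * f x ∂(stdGaussian E)
        - (∫ x, u x ∂(stdGaussian E)) * ∫ x, f x ∂(stdGaussian E)
      = ∫ p : E × E, u p.1 * (f p.1 - f p.2) ∂((stdGaussian E).prod (stdGaussian E)) := by
    simp_rw [mul_sub]
    rw [integral_sub (huf.comp_fst (stdGaussian E)) (hu1.mul_prod hf1), integral_prod_mul,
      integral_fun_fst (μ := stdGaussian E) (ν := stdGaussian E) (fun x => u x * f x)]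
    simp
  rw [hL, integral_inner_mehler hgu hgf hu' hf']
  simp_rw [mul_sub_eq_neg_integral_rotation hf (u _)]
  rw [integral_neg, integral_integral_swap
    (integrable_mul_inner_rotation hu.continuous hgf hu2 hf'), ← integral_neg]
  refine integral_congr_ae (ae_of_all _ fun θ => ?_)
  have hr := measurePreserving_rotation (E := E) θ
  -- Rotating back moves the rotation from `∇f` onto `u`, at angle `-θ`. The sign of `sin (-θ)` from
  -- the integration by parts then cancels the minus sign of the quarter-circle formula.
  have s1 : ∫ p : E × E, u p.1 * ⟪gradient f (ContinuousLinearMap.rotation θ p).1,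
        (ContinuousLinearMap.rotation θ p).2⟫ ∂((stdGaussian E).prod (stdGaussian E))
      = ∫ p : E × E, u (ContinuousLinearMap.rotation (-θ) p).1 * ⟪gradient f p.1, p.2⟫
        ∂((stdGaussian E).prod (stdGaussian E)) := by
    symm
    rw [← hr.hasLaw.integral_comp]
    · simp only [Function.comp_def, rotation_neg_rotation]
    · exact ((hu.continuous.comp (by fun_prop)).mul ((hgf.comp continuous_fst).inner
        continuous_snd)).aestronglyMeasurable
  have s2 : ∫ p : E × E, ⟪gradient u p.1, gradient f (ContinuousLinearMap.rotation θ p).1⟫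
        ∂((stdGaussian E).prod (stdGaussian E))
      = ∫ p : E × E, ⟪gradient u (ContinuousLinearMap.rotation (-θ) p).1, gradient f p.1⟫
        ∂((stdGaussian E).prod (stdGaussian E)) := by
    symm
    rw [← hr.hasLaw.integral_comp]
    · simp only [Function.comp_def, rotation_neg_rotation]
    · exact ((hgu.comp (by fun_prop)).inner (hgf.comp continuous_fst)).aestronglyMeasurable
  dsimp only
  rw [s1, s2, integral_rotation_mul_inner hu hgf hu2 hu' hf' (-θ), integral_const_mul]
  simp

theorem memLp_two_of_lintegral_enorm_sq_ne_top {α G : Type*} [MeasurableSpace α]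
    [NormedAddCommGroup G] {μ : Measure α} {w : α → G} (hw : AEStronglyMeasurable w μ)
    (h : ∫⁻ x, ‖w x‖ₑ ^ 2 ∂μ ≠ ∞) : MemLp w 2 μ := by
  refine ⟨hw, ?_⟩
  rw [eLpNorm_lt_top_iff_lintegral_rpow_enorm_lt_top (by simp) (by simp)]
  simpa using h.lt_top

theorem lintegral_enorm_sq_eq_ofReal {α : Type*} [MeasurableSpace α]
    {μ : Measure α} {G : Type*} [NormedAddCommGroup G] {w : α → G} (hw : MemLp w 2 μ) :
    ∫⁻ x, ‖w x‖ₑ ^ 2 ∂μ = ENNReal.ofReal (∫ x, ‖w x‖ ^ 2 ∂μ) := by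
  rw [ofReal_integral_eq_lintegral_ofReal (hw.integrable_norm_pow two_ne_zero)
    (ae_of_all _ fun x => by positivity)]
  refine lintegral_congr fun x => ?_
  rw [ENNReal.ofReal_pow (norm_nonneg _), ofReal_norm]

/-- Gaussian Poincaré inequality. -/
theorem poincare_stdGaussian {w : E → ℝ} (hw : ContDiff ℝ 1 w) (hw2 : MemLp w 2 (stdGaussian E)) :
    ∫⁻ x, ‖w x - ∫ y, w y ∂(stdGaussian E)‖ₑ ^ 2 ∂(stdGaussian E)
      ≤ ∫⁻ x, ‖gradient w x‖ₑ ^ 2 ∂(stdGaussian E) := by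
  by_cases hfin : ∫⁻ x, ‖gradient w x‖ₑ ^ 2 ∂(stdGaussian E) = ∞
  · rw [hfin]; exact le_top
  have hg := continuous_gradient hw
  have hw' : MemLp (gradient w) 2 (stdGaussian E) :=
    memLp_two_of_lintegral_enorm_sq_ne_top hg.aestronglyMeasurable hfin
  rw [lintegral_enorm_sq_eq_ofReal hw', lintegral_enorm_sq_eq_ofReal
    (w := fun x => w x - ∫ y, w y ∂(stdGaussian E)) (hw2.sub (memLp_const _))]
  refine ENNReal.ofReal_le_ofReal ?_
  set m := ∫ y, w y ∂(stdGaussian E) with hm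
  have hww : Integrable (fun x => w x * w x) (stdGaussian E) := hw2.integrable_mul hw2
  have hw1 := hw2.integrable one_le_two
  have e1 : ∫ x, ‖w x - m‖ ^ 2 ∂(stdGaussian E) = ∫ x, w x * w x ∂(stdGaussian E) - m * m := by
    have : ∀ x, ‖w x - m‖ ^ 2 = w x * w x - (2 * m) * w x + m * m := fun x => by
      rw [Real.norm_eq_abs, sq_abs]; ring
    simp_rw [this]
    rw [integral_add (f := fun x => w x * w x - 2 * m * w x) (hww.sub (hw1.const_mul _))
      (integrable_const _),
      integral_sub hww (hw1.const_mul _), integral_const_mul, ← hm]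
    simp
    ring
  rw [e1, covariance_stdGaussian hw hw hw2 hw2 hw' hw']
  have i1 : Integrable (fun p : E × (ℝ × E) => ‖gradient w p.1‖ ^ 2)
      ((stdGaussian E).prod (mehlerLaw E)) :=
    (hw'.integrable_norm_pow two_ne_zero).comp_fst _
  have i2 : Integrable (fun p : E × (ℝ × E) => ‖gradient w (mehler p)‖ ^ 2)
      ((stdGaussian E).prod (mehlerLaw E)) :=
    measurePreserving_mehler.integrable_comp_of_integrable
      (hw'.integrable_norm_pow two_ne_zero)
  -- Here the factor `1/2` matters: both squared norms have the same expectation, so the Poincaré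
  -- constant comes out as `1`.
  calc ∫ p, ⟪gradient w p.1, gradient w (mehler p)⟫ ∂((stdGaussian E).prod (mehlerLaw E))
      ≤ ∫ p : E × (ℝ × E), (‖gradient w p.1‖ ^ 2 + ‖gradient w (mehler p)‖ ^ 2) / 2
          ∂((stdGaussian E).prod (mehlerLaw E)) := by
        refine integral_mono (integrable_inner_mehler hg hg hw' hw') ((i1.add i2).div_const 2)
          fun p => ?_
        have h1 := real_inner_le_norm (gradient w p.1) (gradient w (mehler p))
        dsimp only
        nlinarith [two_mul_le_add_sq ‖gradient w p.1‖ ‖gradient w (mehler p)‖]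
    _ = ∫ x, ‖gradient w x‖ ^ 2 ∂(stdGaussian E) := by
        rw [integral_div, integral_add i1 i2,
          integral_fun_fst (ν := mehlerLaw E) (fun x => ‖gradient w x‖ ^ 2)]
        have := measurePreserving_mehler.hasLaw.integral_comp
          (hw'.integrable_norm_pow two_ne_zero).aestronglyMeasurable
        simp only [Function.comp_def] at this
        rw [this]
        simp

/-- Variance of an average of differentiable functions. -/
theorem lintegral_integral_sub_sq_le {𝓠 : Type*} [MeasurableSpace 𝓠] (ρ : Measure 𝓠)
    [IsProbabilityMeasure ρ] {Ψ : E × 𝓠 → ℝ} (hΨ : MemLp Ψ 2 ((stdGaussian E).prod ρ))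
    (hm : Measurable Ψ)
    (hC : ∀ q, ContDiff ℝ 1 fun x => Ψ (x, q))
    (hg : Measurable fun p : E × 𝓠 => ‖gradient (fun x => Ψ (x, p.2)) p.1‖ₑ) :
    ∫⁻ x, ‖∫ q, Ψ (x, q) ∂ρ - ∫ p, Ψ p ∂((stdGaussian E).prod ρ)‖ₑ ^ 2 ∂(stdGaussian E)
      ≤ ∫⁻ p, ‖gradient (fun x => Ψ (x, p.2)) p.1‖ₑ ^ 2 ∂((stdGaussian E).prod ρ) := by
  set γ := stdGaussian E
  have hΨ1 := hΨ.integrable one_le_two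
  -- Centring at a mean depending on `q` makes the inner integral a variance once the integrals are
  -- swapped, so that Poincaré applies for each `q`; the outer average is handled by Jensen.
  set m : 𝓠 → ℝ := fun q => ∫ x, Ψ (x, q) ∂γ with hmdef
  have hmm : Measurable m := (hm.stronglyMeasurable.integral_prod_left' (μ := γ)).measurable
  have hmi : Integrable m ρ := hΨ1.integral_prod_right
  have hsq : Integrable (fun p => Ψ p ^ 2) (γ.prod ρ) := hΨ.integrable_sq
  calc ∫⁻ x, ‖∫ q, Ψ (x, q) ∂ρ - ∫ p, Ψ p ∂(γ.prod ρ)‖ₑ ^ 2 ∂γ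
      ≤ ∫⁻ x, ∫⁻ q, ‖Ψ (x, q) - m q‖ₑ ^ 2 ∂ρ ∂γ := by
        refine lintegral_mono_ae ?_
        filter_upwards [hΨ1.prod_right_ae] with x hx
        rw [integral_prod_symm _ hΨ1, ← integral_sub hx hmi]
        calc ‖∫ q, (Ψ (x, q) - m q) ∂ρ‖ₑ ^ 2
            ≤ (eLpNorm (fun q => Ψ (x, q) - m q) 1 ρ) ^ 2 := by
              gcongr
              rw [eLpNorm_one_eq_lintegral_enorm]
              exact enorm_integral_le_lintegral_enorm _
          _ ≤ (eLpNorm (fun q => Ψ (x, q) - m q) 2 ρ) ^ 2 := by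
              gcongr
              exact eLpNorm_le_eLpNorm_of_exponent_le one_le_two
                (hx.sub hmi).aestronglyMeasurable
          _ = ∫⁻ q, ‖Ψ (x, q) - m q‖ₑ ^ 2 ∂ρ := by
              rw [eLpNorm_eq_lintegral_rpow_enorm_toReal (by simp) (by simp), ← ENNReal.rpow_natCast,
                ← ENNReal.rpow_mul]
              simp
    _ = ∫⁻ q, ∫⁻ x, ‖Ψ (x, q) - m q‖ₑ ^ 2 ∂γ ∂ρ := by
        refine lintegral_lintegral_swap (Measurable.aemeasurable ?_)
        exact ((hm.sub (hmm.comp measurable_snd)).enorm.pow_const 2)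
    _ ≤ ∫⁻ q, ∫⁻ x, ‖gradient (fun x => Ψ (x, q)) x‖ₑ ^ 2 ∂γ ∂ρ := by
        refine lintegral_mono_ae ?_
        filter_upwards [hsq.prod_left_ae] with q hq
        refine poincare_stdGaussian (hC q) ?_
        exact (memLp_two_iff_integrable_sq (hC q).continuous.aestronglyMeasurable).2 hq
    _ = ∫⁻ p, ‖gradient (fun x => Ψ (x, p.2)) p.1‖ₑ ^ 2 ∂(γ.prod ρ) := by
        rw [lintegral_prod_symm _ (hg.pow_const 2).aemeasurable]

end

section

/-! ### The second order bound -/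

variable {d : ℕ}

theorem gradient_apply (f : EuclideanSpace ℝ (Fin d) → ℝ) (x : EuclideanSpace ℝ (Fin d))
    (i : Fin d) : gradient f x i = partialDeriv i f x := by
  rw [partialDeriv, ← inner_gradient_left, EuclideanSpace.inner_single_right]
  simp

theorem contDiff_partialDeriv {f : EuclideanSpace ℝ (Fin d) → ℝ} (hf : ContDiff ℝ 2 f)
    (i : Fin d) : ContDiff ℝ 1 (partialDeriv i f) :=
  (hf.fderiv_right (m := 1) (by norm_num)).clm_apply contDiff_const

theorem continuous_hessianEntry {f : EuclideanSpace ℝ (Fin d) → ℝ} (hf : ContDiff ℝ 2 f)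
    (i j : Fin d) : Continuous (hessianEntry i j f) :=
  ((contDiff_partialDeriv hf j).continuous_fderiv one_ne_zero).clm_apply continuous_const

theorem hessianEntry_comm {f : EuclideanSpace ℝ (Fin d) → ℝ} (hf : ContDiff ℝ 2 f)
    (i j : Fin d) (x : EuclideanSpace ℝ (Fin d)) :
    hessianEntry i j f x = hessianEntry j i f x := by
  have hd : DifferentiableAt ℝ (fderiv ℝ f) x :=
    (hf.fderiv_right (m := 1) (by norm_num)).differentiable one_ne_zero x
  have key : ∀ i j : Fin d, hessianEntry i j f x
      = fderiv ℝ (fderiv ℝ f) x (EuclideanSpace.single i 1) (EuclideanSpace.single j 1) := by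
    intro i j
    unfold hessianEntry partialDeriv
    rw [fderiv_clm_apply hd (differentiableAt_const _)]
    simp
  rw [key, key]
  exact (hf.contDiffAt.isSymmSndFDerivAt (by simp)) _ _

theorem inner_gradient_gradient (f : EuclideanSpace ℝ (Fin d) → ℝ)
    (x y : EuclideanSpace ℝ (Fin d)) :
    ⟪gradient f x, gradient f y⟫ = ∑ i, partialDeriv i f x * partialDeriv i f y := by
  rw [PiLp.inner_apply]
  simp [gradient_apply, mul_comm]

/-- The sum under the square root of the second order quantity, for the Gaussian measure. -/
noncomputable def hessianGradientSum (f : EuclideanSpace ℝ (Fin d) → ℝ) : ℝ≥0∞ :=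
  ∑ i : Fin d, ∑ l : Fin d,
    (∫⁻ x, ENNReal.ofReal ((∑ j : Fin d, hessianEntry i j f x * hessianEntry l j f x) ^ 2)
        ∂(stdGaussian (EuclideanSpace ℝ (Fin d)))) ^ (1 / 2 : ℝ)
      * (∫⁻ x, ENNReal.ofReal ((partialDeriv i f x * partialDeriv l f x) ^ 2)
        ∂(stdGaussian (EuclideanSpace ℝ (Fin d)))) ^ (1 / 2 : ℝ)

theorem ofReal_sq_eq_enorm_rpow (a : ℝ) : ENNReal.ofReal (a ^ 2) = ‖a‖ₑ ^ (2 : ℝ) := by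
  rw [← sq_abs, ENNReal.ofReal_pow (abs_nonneg _), ← Real.norm_eq_abs, ofReal_norm]
  simp

/-- Expanding the square pairs the `(i, l)` entry of Hessian times transposed Hessian at `a` with
`∂ᵢf ∂ₗf` at `b`, and Cauchy–Schwarz separates the two. Only the marginal laws of `a` and `b` enter,
not their dependence. -/
theorem lintegral_hessian_gradient_le {S : Type*} [MeasurableSpace S] {ρ : Measure S}
    {f : EuclideanSpace ℝ (Fin d) → ℝ} (hf : ContDiff ℝ 2 f) {a b : S → EuclideanSpace ℝ (Fin d)}
    (ha : MeasurePreserving a ρ (stdGaussian (EuclideanSpace ℝ (Fin d))))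
    (hb : MeasurePreserving b ρ (stdGaussian (EuclideanSpace ℝ (Fin d)))) :
    ∫⁻ s, ENNReal.ofReal (∑ j, (∑ i, hessianEntry i j f (a s) * partialDeriv i f (b s)) ^ 2) ∂ρ
      ≤ hessianGradientSum f := by
  have hcH := fun i j => (continuous_hessianEntry hf i j).measurable
  have hcp := fun i => (contDiff_partialDeriv hf i).continuous.measurable
  set M : Fin d → Fin d → EuclideanSpace ℝ (Fin d) → ℝ :=
    fun i l x => ∑ j : Fin d, hessianEntry i j f x * hessianEntry l j f x with hM
  set G : Fin d → Fin d → EuclideanSpace ℝ (Fin d) → ℝ :=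
    fun i l x => partialDeriv i f x * partialDeriv l f x with hG
  have hMm : ∀ i l, Measurable (M i l) := fun i l =>
    Finset.measurable_sum _ fun j _ => (hcH i j).mul (hcH l j)
  have hGm : ∀ i l, Measurable (G i l) := fun i l => (hcp i).mul (hcp l)
  have hexp : ∀ s, ∑ j, (∑ i, hessianEntry i j f (a s) * partialDeriv i f (b s)) ^ 2
      = ∑ i, ∑ l, M i l (a s) * G i l (b s) := fun s => by
    simp only [hM, hG]
    simp only [sq, Finset.sum_mul_sum]
    rw [Finset.sum_comm]
    refine Finset.sum_congr rfl fun i _ => ?_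
    rw [Finset.sum_comm]
    refine Finset.sum_congr rfl fun l _ => ?_
    rw [Finset.sum_mul]
    exact Finset.sum_congr rfl fun j _ => by ring
  calc ∫⁻ s, ENNReal.ofReal
          (∑ j, (∑ i, hessianEntry i j f (a s) * partialDeriv i f (b s)) ^ 2) ∂ρ
      ≤ ∫⁻ s, ∑ i, ∑ l, ‖M i l (a s)‖ₑ * ‖G i l (b s)‖ₑ ∂ρ := by
        refine lintegral_mono fun s => ?_
        rw [hexp]
        refine (Real.ofReal_le_enorm _).trans ?_
        refine (enorm_sum_le _ _).trans (Finset.sum_le_sum fun i _ => ?_)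
        refine (enorm_sum_le _ _).trans (Finset.sum_le_sum fun l _ => ?_)
        rw [enorm_mul]
    _ = ∑ i, ∑ l, ∫⁻ s, ‖M i l (a s)‖ₑ * ‖G i l (b s)‖ₑ ∂ρ := by
        have hms : ∀ i l, Measurable fun s => ‖M i l (a s)‖ₑ * ‖G i l (b s)‖ₑ := fun i l =>
          ((hMm i l).comp ha.measurable).enorm.mul ((hGm i l).comp hb.measurable).enorm
        rw [lintegral_finsetSum _ fun i _ => Finset.measurable_sum _ fun l _ => hms i l]
        exact Finset.sum_congr rfl fun i _ => lintegral_finsetSum _ fun l _ => hms i l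
    _ ≤ hessianGradientSum f := by
        refine Finset.sum_le_sum fun i _ => Finset.sum_le_sum fun l _ => ?_
        refine (ENNReal.lintegral_mul_le_Lp_mul_Lq ρ Real.HolderConjugate.two_two
          ((hMm i l).comp ha.measurable).enorm.aemeasurable
          ((hGm i l).comp hb.measurable).enorm.aemeasurable).trans (le_of_eq ?_)
        simp_rw [ofReal_sq_eq_enorm_rpow]
        rw [← ha.lintegral_comp ((hMm i l).enorm.pow_const _),
          ← hb.lintegral_comp ((hGm i l).enorm.pow_const _)]
        rfl

/-- The diagonal term `l = i` contains the fourth moment of `∂ᵢf`. The convention `0 * ∞ = 0` could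
hide an infinite one, but only if row `i` of the Hessian vanishes almost everywhere; Poincaré then
makes `∂ᵢf` almost everywhere constant. -/
theorem memLp_partialDeriv {f : EuclideanSpace ℝ (Fin d) → ℝ} (hf : ContDiff ℝ 2 f)
    (hA : hessianGradientSum f ≠ ∞) (i : Fin d) :
    MemLp (partialDeriv i f) 4 (stdGaussian (EuclideanSpace ℝ (Fin d))) := by
  have hi := contDiff_partialDeriv hf i
  by_cases htop : ∫⁻ x, ENNReal.ofReal ((partialDeriv i f x * partialDeriv i f x) ^ 2)
        ∂(stdGaussian (EuclideanSpace ℝ (Fin d))) = ∞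
  · have hterm := (ENNReal.sum_ne_top.1 ((ENNReal.sum_ne_top.1 hA) i (Finset.mem_univ _))) i
      (Finset.mem_univ _)
    rw [htop, ENNReal.top_rpow_of_pos (by norm_num)] at hterm
    have h0 : ∫⁻ x, ENNReal.ofReal
        ((∑ j : Fin d, hessianEntry i j f x * hessianEntry i j f x) ^ 2)
        ∂(stdGaussian (EuclideanSpace ℝ (Fin d))) = 0 := by
      by_contra hne
      refine hterm (ENNReal.mul_top ?_)
      simp [hne]
    have hmeas : Measurable fun x => ENNReal.ofReal
        ((∑ j : Fin d, hessianEntry i j f x * hessianEntry i j f x) ^ 2) :=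
      ((Finset.measurable_sum _ fun j _ => (continuous_hessianEntry hf i j).measurable.mul
        (continuous_hessianEntry hf i j).measurable).pow_const 2).ennreal_ofReal
    rw [lintegral_eq_zero_iff hmeas] at h0
    -- Square integrability of `∂ᵢf` is not yet known, so Poincaré is applied to a bounded injective
    -- function of it.
    set w : EuclideanSpace ℝ (Fin d) → ℝ := fun x => Real.arctan (partialDeriv i f x) with hw
    have hwC : ContDiff ℝ 1 w := Real.contDiff_arctan.comp hi
    have hw2 : MemLp w 2 (stdGaussian (EuclideanSpace ℝ (Fin d))) :=
      MemLp.of_bound hwC.continuous.aestronglyMeasurable (π / 2) (ae_of_all _ fun x => by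
        rw [Real.norm_eq_abs, abs_le]
        exact ⟨(Real.neg_pi_div_two_lt_arctan _).le, (Real.arctan_lt_pi_div_two _).le⟩)
    have hgrad : ∀ᵐ x ∂(stdGaussian (EuclideanSpace ℝ (Fin d))), ‖gradient w x‖ₑ ^ 2 = 0 := by
      filter_upwards [h0] with x hx
      have hx' : ∑ j : Fin d, hessianEntry i j f x * hessianEntry i j f x = 0 := by
        have h1 : (∑ j : Fin d, hessianEntry i j f x * hessianEntry i j f x) ^ 2 ≤ 0 :=
          ENNReal.ofReal_eq_zero.1 hx
        exact pow_eq_zero_iff two_ne_zero |>.1 (le_antisymm h1 (sq_nonneg _))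
      have hz : ∀ j, hessianEntry i j f x = 0 := fun j => by
        have := (Finset.sum_eq_zero_iff_of_nonneg fun j _ => mul_self_nonneg _).1 hx' j
          (Finset.mem_univ _)
        simpa using this
      have hg0 : gradient w x = 0 := by
        ext j
        rw [gradient_apply, partialDeriv, hw]
        rw [((hi.differentiable one_ne_zero x).hasFDerivAt.arctan).fderiv]
        have hj : fderiv ℝ (partialDeriv i f) x (EuclideanSpace.single j 1) = 0 := by
          have := hz j
          rw [hessianEntry_comm hf] at this
          exact this
        simp [hj]
      simp [hg0]
    have hP := poincare_stdGaussian hwC hw2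
    rw [lintegral_congr_ae hgrad, lintegral_zero, nonpos_iff_eq_zero, lintegral_eq_zero_iff
      ((hwC.continuous.measurable.sub_const _).enorm.pow_const 2)] at hP
    set c := ∫ y, w y ∂(stdGaussian (EuclideanSpace ℝ (Fin d)))
    refine (memLp_congr_ae (g := fun _ => Real.tan c) ?_).2 (memLp_const _)
    filter_upwards [hP] with x hx
    have : w x = c := by simpa [sub_eq_zero] using hx
    rw [← this, hw, Real.tan_arctan]
  · refine ⟨hi.continuous.aestronglyMeasurable, ?_⟩
    rw [eLpNorm_lt_top_iff_lintegral_rpow_enorm_lt_top (by simp) (by simp)]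
    refine lt_of_eq_of_lt (lintegral_congr fun x => ?_) (lt_top_iff_ne_top.2 htop)
    rw [ofReal_sq_eq_enorm_rpow, enorm_mul]
    simp
    ring

theorem memLp_gradient {f : EuclideanSpace ℝ (Fin d) → ℝ} (hf : ContDiff ℝ 2 f)
    (hA : hessianGradientSum f ≠ ∞) :
    MemLp (gradient f) 4 (stdGaussian (EuclideanSpace ℝ (Fin d))) := by
  have h : gradient f = fun x => ∑ i, partialDeriv i f x • EuclideanSpace.single i (1 : ℝ) := by
    ext x j
    simp [gradient_apply, Pi.single_apply]
  rw [h]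
  refine memLp_finsetSum _ fun i _ => ?_
  refine (memLp_partialDeriv hf hA i).of_le ?_ (ae_of_all _ fun x => by simp [norm_smul])
  exact ((contDiff_partialDeriv hf i).continuous.smul continuous_const).aestronglyMeasurable

/-! ### Variance of the averaged gradient pairing. -/

/-- The integrand `⟪∇f(x), ∇f(cos θ x + sin θ y)⟫` of the Mehler representation. -/
noncomputable def gradientPairing (f : EuclideanSpace ℝ (Fin d) → ℝ)
    (p : EuclideanSpace ℝ (Fin d) × (ℝ × EuclideanSpace ℝ (Fin d))) : ℝ :=
  ⟪gradient f p.1, gradient f (mehler p)⟫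

theorem continuous_gradientPairing {f : EuclideanSpace ℝ (Fin d) → ℝ} (hf : ContDiff ℝ 2 f) :
    Continuous (gradientPairing f) := by
  have := continuous_gradient (hf.of_le one_le_two)
  exact (this.comp continuous_fst).inner (this.comp continuous_mehler)

theorem memLp_gradientPairing {f : EuclideanSpace ℝ (Fin d) → ℝ} (hf : ContDiff ℝ 2 f)
    (hA : hessianGradientSum f ≠ ∞) :
    MemLp (gradientPairing f) 2 ((stdGaussian (EuclideanSpace ℝ (Fin d))).prod
      (mehlerLaw (EuclideanSpace ℝ (Fin d)))) := by
  have h4 : MemLp (fun x => ‖gradient f x‖ ^ 2) 2 (stdGaussian (EuclideanSpace ℝ (Fin d))) := by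
    have := (memLp_gradient hf hA).norm_rpow_div 2
    have e : (4 : ℝ≥0∞) / 2 = 2 := by
      rw [show (4 : ℝ≥0∞) = 2 * 2 by norm_num]
      exact ENNReal.mul_div_cancel_right (by simp) (by simp)
    simpa [e] using this
  have m1 : MemLp (fun p : EuclideanSpace ℝ (Fin d) × (ℝ × EuclideanSpace ℝ (Fin d)) =>
      ‖gradient f p.1‖ ^ 2) 2 ((stdGaussian (EuclideanSpace ℝ (Fin d))).prod
      (mehlerLaw (EuclideanSpace ℝ (Fin d)))) := h4.comp_measurePreserving measurePreserving_fst
  have m2 : MemLp (fun p : EuclideanSpace ℝ (Fin d) × (ℝ × EuclideanSpace ℝ (Fin d)) =>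
      ‖gradient f (mehler p)‖ ^ 2) 2 ((stdGaussian (EuclideanSpace ℝ (Fin d))).prod
      (mehlerLaw (EuclideanSpace ℝ (Fin d)))) :=
    h4.comp_measurePreserving measurePreserving_mehler
  refine (m1.add m2).mono' (continuous_gradientPairing hf).aestronglyMeasurable
    (ae_of_all _ fun p => norm_inner_le_add_sq _ _)

theorem contDiff_gradientPairing {f : EuclideanSpace ℝ (Fin d) → ℝ} (hf : ContDiff ℝ 2 f)
    (q : ℝ × EuclideanSpace ℝ (Fin d)) : ContDiff ℝ 1 fun x => gradientPairing f (x, q) := by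
  simp only [gradientPairing, inner_gradient_gradient, mehler]
  refine ContDiff.sum fun i _ => (contDiff_partialDeriv hf i).mul ?_
  exact (contDiff_partialDeriv hf i).comp
    ((contDiff_id.const_smul _).add contDiff_const)

/-- Product rule; the cosine is the `x`-derivative of the interpolation. Symmetry of the Hessian
moves the direction `j` to the second index, the one summed over in the second order quantity. -/
theorem partialDeriv_gradientPairing {f : EuclideanSpace ℝ (Fin d) → ℝ} (hf : ContDiff ℝ 2 f)
    (p : EuclideanSpace ℝ (Fin d) × (ℝ × EuclideanSpace ℝ (Fin d))) (j : Fin d) :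
    partialDeriv j (fun x => gradientPairing f (x, p.2)) p.1
      = ∑ i, hessianEntry i j f p.1 * partialDeriv i f (mehler p)
        + Real.cos p.2.1 * ∑ i, hessianEntry i j f (mehler p) * partialDeriv i f p.1 := by
  obtain ⟨x, q⟩ := p
  have hm : HasFDerivAt (fun x : EuclideanSpace ℝ (Fin d) => mehler (x, q))
      (Real.cos q.1 • ContinuousLinearMap.id ℝ _) x := by
    have := ((hasFDerivAt_id (𝕜 := ℝ) x).const_smul (Real.cos q.1)).add_const
      (Real.sin q.1 • q.2)
    exact this
  have hD : HasFDerivAt (fun x => gradientPairing f (x, q))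
      (∑ i, (partialDeriv i f x • ((fderiv ℝ (partialDeriv i f) (mehler (x, q))).comp
          (Real.cos q.1 • ContinuousLinearMap.id ℝ _))
        + partialDeriv i f (mehler (x, q)) • fderiv ℝ (partialDeriv i f) x)) x := by
    simp only [gradientPairing, inner_gradient_gradient]
    refine HasFDerivAt.fun_sum fun i _ => ?_
    have hi := (contDiff_partialDeriv hf i).differentiable one_ne_zero
    have h2 : HasFDerivAt (fun x => partialDeriv i f (mehler (x, q)))
        ((fderiv ℝ (partialDeriv i f) (mehler (x, q))).comp
          (Real.cos q.1 • ContinuousLinearMap.id ℝ _)) x :=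
      HasFDerivAt.comp (g := partialDeriv i f) (f := fun x => mehler (x, q)) x
        (hi (mehler (x, q))).hasFDerivAt hm
    exact (hi x).hasFDerivAt.mul h2
  rw [partialDeriv, hD.fderiv, Finset.mul_sum, ← Finset.sum_add_distrib]
  simp only [_root_.sum_apply]
  refine Finset.sum_congr rfl fun i _ => ?_
  rw [hessianEntry_comm hf i j, hessianEntry_comm hf i j]
  simp [hessianEntry, partialDeriv]
  ring

theorem norm_sq_gradient (w : EuclideanSpace ℝ (Fin d) → ℝ) (x : EuclideanSpace ℝ (Fin d)) :
    ‖gradient w x‖ ^ 2 = ∑ j, partialDeriv j w x ^ 2 := by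
  rw [EuclideanSpace.real_norm_sq_eq]
  simp [gradient_apply]

theorem lintegral_variance_gradientPairing_le {f : EuclideanSpace ℝ (Fin d) → ℝ}
    (hf : ContDiff ℝ 2 f) (hA : hessianGradientSum f ≠ ∞) :
    ∫⁻ x, ‖∫ q, gradientPairing f (x, q) ∂(mehlerLaw (EuclideanSpace ℝ (Fin d)))
        - ∫ p, gradientPairing f p ∂((stdGaussian (EuclideanSpace ℝ (Fin d))).prod
          (mehlerLaw (EuclideanSpace ℝ (Fin d))))‖ₑ ^ 2 ∂(stdGaussian (EuclideanSpace ℝ (Fin d)))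
      ≤ 4 * hessianGradientSum f := by
  have hcH := fun i j => (continuous_hessianEntry hf i j)
  have hcp := fun i => (contDiff_partialDeriv hf i).continuous
  have hcm := continuous_mehler (E := EuclideanSpace ℝ (Fin d))
  have hcP : ∀ j, Continuous fun p : EuclideanSpace ℝ (Fin d) × (ℝ × EuclideanSpace ℝ (Fin d)) =>
      partialDeriv j (fun x => gradientPairing f (x, p.2)) p.1 := fun j => by
    simp only [partialDeriv_gradientPairing hf]
    exact (continuous_finsetSum _ fun i _ => ((hcH i j).comp continuous_fst).mul
      ((hcp i).comp hcm)).add ((Real.continuous_cos.comp (by fun_prop)).mul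
      (continuous_finsetSum _ fun i _ => ((hcH i j).comp hcm).mul ((hcp i).comp continuous_fst)))
  have hnorm : ∀ p : EuclideanSpace ℝ (Fin d) × (ℝ × EuclideanSpace ℝ (Fin d)),
      ‖gradient (fun x => gradientPairing f (x, p.2)) p.1‖
      = √(∑ j, partialDeriv j (fun x => gradientPairing f (x, p.2)) p.1 ^ 2) := fun p => by
    rw [← norm_sq_gradient, Real.sqrt_sq (norm_nonneg _)]
  have hmeas : Measurable fun p : EuclideanSpace ℝ (Fin d) × (ℝ × EuclideanSpace ℝ (Fin d)) =>
      ‖gradient (fun x => gradientPairing f (x, p.2)) p.1‖ₑ := by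
    simp only [← ofReal_norm, hnorm]
    exact (continuous_finsetSum _ fun j _ => (hcP j).pow 2).sqrt.measurable.ennreal_ofReal
  refine (lintegral_integral_sub_sq_le _ (memLp_gradientPairing hf hA)
    (continuous_gradientPairing hf).measurable (contDiff_gradientPairing hf) hmeas).trans ?_
  set T₁ : EuclideanSpace ℝ (Fin d) × (ℝ × EuclideanSpace ℝ (Fin d)) → ℝ := fun p =>
    ∑ j, (∑ i, hessianEntry i j f p.1 * partialDeriv i f (mehler p)) ^ 2 with hT₁
  set T₂ : EuclideanSpace ℝ (Fin d) × (ℝ × EuclideanSpace ℝ (Fin d)) → ℝ := fun p =>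
    ∑ j, (∑ i, hessianEntry i j f (mehler p) * partialDeriv i f p.1) ^ 2 with hT₂
  have hT₁m : Measurable T₁ := (continuous_finsetSum _ fun j _ => (continuous_finsetSum _
    fun i _ => ((hcH i j).comp continuous_fst).mul ((hcp i).comp hcm)).pow 2).measurable
  have hT₂m : Measurable T₂ := (continuous_finsetSum _ fun j _ => (continuous_finsetSum _
    fun i _ => ((hcH i j).comp hcm).mul ((hcp i).comp continuous_fst)).pow 2).measurable
  have hpt : ∀ p, ‖gradient (fun x => gradientPairing f (x, p.2)) p.1‖ₑ ^ 2
      ≤ 2 * ENNReal.ofReal (T₁ p) + 2 * ENNReal.ofReal (T₂ p) := fun p => by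
    -- From `(s + c t)² ≤ 2 s² + 2 c² t²` with `c = cos θ` and `c² ≤ 1`. Each of the two terms
    -- contributes `2 * hessianGradientSum f`, whence the `4`.
    have h1 : ‖gradient (fun x => gradientPairing f (x, p.2)) p.1‖ ^ 2 ≤ 2 * T₁ p + 2 * T₂ p := by
      rw [norm_sq_gradient, hT₁, hT₂, Finset.mul_sum, Finset.mul_sum, ← Finset.sum_add_distrib]
      refine Finset.sum_le_sum fun j _ => ?_
      rw [partialDeriv_gradientPairing hf]
      set s := ∑ i, hessianEntry i j f p.1 * partialDeriv i f (mehler p)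
      set t := ∑ i, hessianEntry i j f (mehler p) * partialDeriv i f p.1
      have hc := Real.cos_sq_le_one p.2.1
      nlinarith [sq_nonneg (s - Real.cos p.2.1 * t), mul_le_mul_of_nonneg_right hc (sq_nonneg t)]
    have hn1 : 0 ≤ T₁ p := Finset.sum_nonneg fun j _ => sq_nonneg _
    have hn2 : 0 ≤ T₂ p := Finset.sum_nonneg fun j _ => sq_nonneg _
    rw [← ofReal_norm, ← ENNReal.ofReal_pow (norm_nonneg _)]
    refine (ENNReal.ofReal_le_ofReal h1).trans (le_of_eq ?_)
    rw [ENNReal.ofReal_add (by positivity) (by positivity), ENNReal.ofReal_mul two_pos.le,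
      ENNReal.ofReal_mul two_pos.le]
    simp
  have hb₁ := lintegral_hessian_gradient_le hf (measurePreserving_fst
    (μ := stdGaussian (EuclideanSpace ℝ (Fin d)))
    (ν := mehlerLaw (EuclideanSpace ℝ (Fin d)))) measurePreserving_mehler
  have hb₂ := lintegral_hessian_gradient_le hf measurePreserving_mehler (measurePreserving_fst
    (μ := stdGaussian (EuclideanSpace ℝ (Fin d)))
    (ν := mehlerLaw (EuclideanSpace ℝ (Fin d))))
  refine (lintegral_mono hpt).trans ?_
  rw [lintegral_add_left (hT₁m.ennreal_ofReal.const_mul _), lintegral_const_mul _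
    hT₁m.ennreal_ofReal, lintegral_const_mul _ hT₂m.ennreal_ofReal]
  calc _ ≤ 2 * hessianGradientSum f + 2 * hessianGradientSum f := by gcongr
    _ = 4 * hessianGradientSum f := by rw [← add_mul]; norm_num

/-- Approximate Stein identity for `f(X)`. -/
theorem abs_integral_stein_le {f : EuclideanSpace ℝ (Fin d) → ℝ}
    (hf : ContDiff ℝ 2 f) (hA : hessianGradientSum f ≠ ∞)
    (hL2 : MemLp f 2 (stdGaussian (EuclideanSpace ℝ (Fin d))))
    (hmean : ∫ x, f x ∂(stdGaussian (EuclideanSpace ℝ (Fin d))) = 0) {σ : ℝ}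
    (hvar : ∫ x, f x ^ 2 ∂(stdGaussian (EuclideanSpace ℝ (Fin d))) = σ ^ 2)
    {g : ℝ → ℝ} (hg : ContDiff ℝ 1 g) {K : ℝ} (hK : ∀ x, |deriv g x| ≤ K) :
    |∫ x, (σ ^ 2 * deriv g (f x) - f x * g (f x)) ∂(stdGaussian (EuclideanSpace ℝ (Fin d)))|
      ≤ K * (2 * (hessianGradientSum f ^ (1 / 2 : ℝ)).toReal) := by
  have hK0 : 0 ≤ K := (abs_nonneg _).trans (hK 0)
  have hf1 : ContDiff ℝ 1 f := hf.of_le one_le_two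
  have hgf := continuous_gradient hf1
  have hf' : MemLp (gradient f) 2 (stdGaussian (EuclideanSpace ℝ (Fin d))) :=
    (memLp_gradient hf hA).mono_exponent (by norm_num)
  have hgc : Continuous (deriv g) := hg.continuous_deriv le_rfl
  have hLip : LipschitzWith K.toNNReal g := by
    refine lipschitzWith_of_nnnorm_deriv_le (hg.differentiable one_ne_zero) fun x => ?_
    rw [← NNReal.coe_le_coe, coe_nnnorm, Real.norm_eq_abs, Real.coe_toNNReal _ hK0]
    exact hK x
  have hu : ContDiff ℝ 1 (fun x => g (f x)) := hg.comp hf1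
  have hu2 : MemLp (fun x => g (f x)) 2 (stdGaussian (EuclideanSpace ℝ (Fin d))) := by
    refine ((memLp_const |g 0|).add (hL2.norm.const_mul K)).mono'
      hu.continuous.aestronglyMeasurable (ae_of_all _ fun x => ?_)
    have := hLip.norm_sub_le (f x) 0
    rw [Real.coe_toNNReal _ hK0, sub_zero] at this
    have h2 := norm_le_norm_add_norm_sub' (g (f x)) (g 0)
    simp only [Pi.add_apply]
    rw [Real.norm_eq_abs (g 0)] at h2
    linarith
  have hug : ∀ x, gradient (fun x => g (f x)) x = deriv g (f x) • gradient f x := fun x => by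
    refine HasGradientAt.gradient ?_
    rw [hasGradientAt_iff_hasFDerivAt, map_smul, toDual_gradient]
    exact ((hg.differentiable one_ne_zero (f x)).hasDerivAt).comp_hasFDerivAt x
      (hf1.differentiable one_ne_zero x).hasFDerivAt
  have hu' : MemLp (gradient fun x => g (f x)) 2 (stdGaussian (EuclideanSpace ℝ (Fin d))) := by
    refine (hf'.norm.const_mul K).mono' (continuous_gradient hu).aestronglyMeasurable
      (ae_of_all _ fun x => ?_)
    rw [hug, norm_smul]
    exact mul_le_mul_of_nonneg_right (hK _) (norm_nonneg _)
  have hΨ1 := (memLp_gradientPairing hf hA).integrable one_le_two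
  have hc1 := covariance_stdGaussian hf1 hf1 hL2 hL2 hf' hf'
  have hc2 := covariance_stdGaussian hu hf1 hu2 hL2 hu' hf'
  rw [hmean, mul_zero, sub_zero] at hc1 hc2
  have hσ : σ ^ 2 = ∫ p, gradientPairing f p ∂((stdGaussian (EuclideanSpace ℝ (Fin d))).prod
      (mehlerLaw (EuclideanSpace ℝ (Fin d)))) := by
    rw [← hvar]
    simp only [sq]
    exact hc1
  -- `Z` acts as a Stein kernel: it has mean `σ²` and replaces `σ²` exactly in Stein's identity, so
  -- the error is governed by its fluctuation.
  set Z : EuclideanSpace ℝ (Fin d) → ℝ := fun x =>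
    ∫ q, gradientPairing f (x, q) ∂(mehlerLaw (EuclideanSpace ℝ (Fin d))) with hZ
  have hZi : Integrable Z (stdGaussian (EuclideanSpace ℝ (Fin d))) := hΨ1.integral_prod_left
  have hgm : AEStronglyMeasurable (fun x => deriv g (f x))
      (stdGaussian (EuclideanSpace ℝ (Fin d))) :=
    (hgc.comp hf1.continuous).aestronglyMeasurable
  have hgb : ∀ᵐ x ∂(stdGaussian (EuclideanSpace ℝ (Fin d))), ‖deriv g (f x)‖ ≤ K :=
    ae_of_all _ fun x => hK _
  have hgZ : ∫ x, f x * g (f x) ∂(stdGaussian (EuclideanSpace ℝ (Fin d)))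
      = ∫ x, deriv g (f x) * Z x ∂(stdGaussian (EuclideanSpace ℝ (Fin d))) := by
    simp_rw [mul_comm (f _)]
    rw [hc2, integral_prod _ (integrable_inner_mehler (continuous_gradient hu) hgf hu' hf')]
    refine integral_congr_ae (ae_of_all _ fun x => ?_)
    simp only [hug, real_inner_smul_left, integral_const_mul, hZ, gradientPairing]
  have hdiff : ∫ x, (σ ^ 2 * deriv g (f x) - f x * g (f x))
        ∂(stdGaussian (EuclideanSpace ℝ (Fin d)))
      = ∫ x, deriv g (f x) * (σ ^ 2 - Z x) ∂(stdGaussian (EuclideanSpace ℝ (Fin d))) := by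
    have i1 : Integrable (fun x => σ ^ 2 * deriv g (f x))
        (stdGaussian (EuclideanSpace ℝ (Fin d))) :=
      (Integrable.of_bound hgm K hgb).const_mul _
    have i2 : Integrable (fun x => f x * g (f x)) (stdGaussian (EuclideanSpace ℝ (Fin d))) :=
      hL2.integrable_mul hu2
    rw [integral_sub i1 i2, hgZ, ← integral_sub i1 (hZi.bdd_mul hgm hgb)]
    exact integral_congr_ae (ae_of_all _ fun x => by ring)
  have hV := lintegral_variance_gradientPairing_le hf hA
  rw [← hσ] at hV
  have hmain : ∫⁻ x, ‖Z x - σ ^ 2‖ₑ ∂(stdGaussian (EuclideanSpace ℝ (Fin d)))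
      ≤ 2 * hessianGradientSum f ^ (1 / 2 : ℝ) := by
    have hle := eLpNorm_le_eLpNorm_of_exponent_le (p := 1) (q := 2) one_le_two
      (hZi.sub (integrable_const (σ ^ 2))).aestronglyMeasurable
    rw [eLpNorm_one_eq_lintegral_enorm,
      eLpNorm_eq_lintegral_rpow_enorm_toReal (by simp) (by simp)] at hle
    refine hle.trans ?_
    simp only [ENNReal.toReal_ofNat, ENNReal.rpow_ofNat, Pi.sub_apply]
    refine (ENNReal.rpow_le_rpow hV (by norm_num)).trans (le_of_eq ?_)
    rw [ENNReal.mul_rpow_of_nonneg _ _ (by norm_num), show (4 : ℝ≥0∞) = 2 ^ (2 : ℝ) by norm_num,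
      ← ENNReal.rpow_mul]
    norm_num
  have hfin : hessianGradientSum f ^ (1 / 2 : ℝ) ≠ ∞ :=
    ENNReal.rpow_ne_top_of_nonneg (by norm_num) hA
  have hreal : ∫ x, ‖Z x - σ ^ 2‖ ∂(stdGaussian (EuclideanSpace ℝ (Fin d)))
      ≤ 2 * (hessianGradientSum f ^ (1 / 2 : ℝ)).toReal := by
    rw [integral_norm_eq_lintegral_enorm (f := fun x => Z x - σ ^ 2)
      (hZi.sub (integrable_const (σ ^ 2))).aestronglyMeasurable]
    have := ENNReal.toReal_mono (ENNReal.mul_ne_top (by simp) hfin) hmain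
    simpa using this
  rw [hdiff, ← Real.norm_eq_abs]
  calc ‖∫ x, deriv g (f x) * (σ ^ 2 - Z x) ∂(stdGaussian (EuclideanSpace ℝ (Fin d)))‖
      ≤ ∫ x, K * ‖Z x - σ ^ 2‖ ∂(stdGaussian (EuclideanSpace ℝ (Fin d))) := by
        refine norm_integral_le_of_norm_le
          ((hZi.sub (integrable_const (σ ^ 2))).norm.const_mul K) (ae_of_all _ fun x => ?_)
        rw [norm_mul, norm_sub_rev]
        exact mul_le_mul_of_nonneg_right (hK _) (norm_nonneg _)
    _ ≤ K * (2 * (hessianGradientSum f ^ (1 / 2 : ℝ)).toReal) := by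
        rw [integral_const_mul]
        exact mul_le_mul_of_nonneg_left hreal hK0

end

section

/-! ### Stein's equation with bounded test functions -/

theorem hasDerivAt_exp_neg_sq (u : ℝ) :
    HasDerivAt (fun u : ℝ => rexp (-u ^ 2 / 2)) (-(u * rexp (-u ^ 2 / 2))) u := by
  have h1 : HasDerivAt (fun x : ℝ => -x ^ 2 / 2) (-u) u :=
    ((hasDerivAt_pow 2 u).neg.div_const 2).congr_deriv (by push_cast; ring)
  exact h1.exp.congr_deriv (by ring)

theorem hasDerivAt_exp_sq (u : ℝ) :
    HasDerivAt (fun u : ℝ => rexp (u ^ 2 / 2)) (u * rexp (u ^ 2 / 2)) u := by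
  have h1 : HasDerivAt (fun x : ℝ => x ^ 2 / 2) u u :=
    ((hasDerivAt_pow 2 u).div_const 2).congr_deriv (by push_cast; ring)
  exact h1.exp.congr_deriv (by ring)

theorem integrable_exp_neg_sq : Integrable fun u : ℝ => rexp (-u ^ 2 / 2) := by
  have := integrable_exp_neg_mul_sq (b := 1 / 2) (by norm_num)
  refine this.congr (ae_of_all _ fun u => ?_)
  ring_nf

theorem integrable_mul_exp_neg_sq : Integrable fun u : ℝ => u * rexp (-u ^ 2 / 2) := by
  have := integrable_mul_exp_neg_mul_sq (b := 1 / 2) (by norm_num)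
  refine this.congr (ae_of_all _ fun u => ?_)
  ring_nf

theorem tendsto_exp_neg_sq : Tendsto (fun u : ℝ => rexp (-u ^ 2 / 2)) atTop (𝓝 0) := by
  refine Real.tendsto_exp_atBot.comp ?_
  have h : Tendsto (fun u : ℝ => u ^ 2 / 2) atTop atTop :=
    (tendsto_pow_atTop two_ne_zero).atTop_div_const two_pos
  refine (tendsto_neg_atTop_atBot.comp h).congr fun u => ?_
  simp [neg_div]

theorem integral_Ioi_mul_exp_neg_sq (x : ℝ) :
    ∫ u in Ioi x, u * rexp (-u ^ 2 / 2) = rexp (-x ^ 2 / 2) := by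
  have h := integral_Ioi_of_hasDerivAt_of_tendsto' (a := x) (m := 0)
    (f := fun u : ℝ => -rexp (-u ^ 2 / 2)) (f' := fun u : ℝ => u * rexp (-u ^ 2 / 2))
    (fun u _ => ((hasDerivAt_exp_neg_sq u).neg).congr_deriv (by ring))
    integrable_mul_exp_neg_sq.integrableOn (by simpa using tendsto_exp_neg_sq.neg)
  rw [h]; ring

/-- Mills ratio bound: replace `x` by the larger `u` under the integral, which can then be computed.
-/
theorem mul_integral_Ioi_exp_neg_sq_le (x : ℝ) :
    x * ∫ u in Ioi x, rexp (-u ^ 2 / 2) ≤ rexp (-x ^ 2 / 2) := by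
  rw [← integral_Ioi_mul_exp_neg_sq, ← integral_const_mul]
  refine setIntegral_mono_on (integrable_exp_neg_sq.const_mul x).integrableOn
    integrable_mul_exp_neg_sq.integrableOn measurableSet_Ioi fun u hu => ?_
  exact mul_le_mul_of_nonneg_right (le_of_lt hu) (Real.exp_pos _).le

theorem neg_mul_integral_Iic_exp_neg_sq_le (x : ℝ) :
    -x * ∫ u in Iic x, rexp (-u ^ 2 / 2) ≤ rexp (-x ^ 2 / 2) := by
  have h := integral_comp_neg_Iic x fun u : ℝ => rexp (-u ^ 2 / 2)
  simp only [neg_sq] at h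
  have h2 := mul_integral_Ioi_exp_neg_sq_le (-x)
  rw [← h, neg_sq] at h2
  exact h2

/-- The weighted centred test function in Stein's equation. -/
noncomputable def steinWeight (k : ℝ → ℝ) (u : ℝ) : ℝ :=
  (k u - ∫ y, k y ∂(gaussianReal 0 1)) * rexp (-u ^ 2 / 2)

/-- The bounded solution of Stein's equation. -/
noncomputable def steinSolution (k : ℝ → ℝ) (x : ℝ) : ℝ :=
  rexp (x ^ 2 / 2) * ∫ u in Iic x, steinWeight k u

variable {k : ℝ → ℝ}

theorem integral_mem_Icc (hk : Continuous k) (h01 : ∀ u, k u ∈ Icc (0 : ℝ) 1) :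
    ∫ y, k y ∂(gaussianReal 0 1) ∈ Icc (0 : ℝ) 1 := by
  have hi : Integrable k (gaussianReal 0 1) :=
    Integrable.of_bound hk.aestronglyMeasurable 1 (ae_of_all _ fun u => by
      rw [Real.norm_eq_abs, abs_of_nonneg (h01 u).1]; exact (h01 u).2)
  refine ⟨integral_nonneg fun u => (h01 u).1, ?_⟩
  have := integral_mono hi (integrable_const 1) fun u => (h01 u).2
  simpa using this

theorem integrable_of_mem_Icc {m : Measure ℝ} [IsFiniteMeasure m] (hk : Continuous k)
    (h01 : ∀ u, k u ∈ Icc (0 : ℝ) 1) : Integrable k m :=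
  Integrable.of_bound hk.aestronglyMeasurable 1 (ae_of_all _ fun u => by
    rw [Real.norm_eq_abs, abs_of_nonneg (h01 u).1]; exact (h01 u).2)

theorem continuous_steinWeight (hk : Continuous k) : Continuous (steinWeight k) := by
  unfold steinWeight; fun_prop

theorem integrable_steinWeight (hk : Continuous k) (h01 : ∀ u, k u ∈ Icc (0 : ℝ) 1) :
    Integrable (steinWeight k) := by
  have hc := integral_mem_Icc hk h01
  refine integrable_exp_neg_sq.bdd_mul (c := 1) (by fun_prop) (ae_of_all _ fun u => ?_)
  rw [Real.norm_eq_abs, abs_le]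
  exact ⟨by linarith [(h01 u).1, hc.2], by linarith [(h01 u).2, hc.1]⟩

theorem integral_steinWeight (hk : Continuous k) (h01 : ∀ u, k u ∈ Icc (0 : ℝ) 1) :
    ∫ u, steinWeight k u = 0 := by
  have h0 : ∫ u, (k u - ∫ y, k y ∂(gaussianReal 0 1)) ∂(gaussianReal 0 1) = 0 := by
    rw [integral_sub (integrable_of_mem_Icc hk h01) (integrable_const _)]
    simp
  rw [integral_gaussianReal_eq_integral_smul one_ne_zero] at h0
  have h1 : ∀ u, gaussianPDFReal 0 1 u • (k u - ∫ y, k y ∂(gaussianReal 0 1))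
      = (√(2 * π))⁻¹ * steinWeight k u := fun u => by
    simp [gaussianPDFReal, steinWeight]
    ring
  simp_rw [h1] at h0
  rw [integral_const_mul] at h0
  refine (mul_eq_zero.1 h0).resolve_left ?_
  positivity

theorem hasDerivAt_steinSolution (hk : Continuous k) (h01 : ∀ u, k u ∈ Icc (0 : ℝ) 1) (x : ℝ) :
    HasDerivAt (steinSolution k)
      (x * steinSolution k x + (k x - ∫ y, k y ∂(gaussianReal 0 1))) x := by
  have hi := integrable_steinWeight hk h01
  have hG : HasDerivAt (fun x => ∫ u in Iic x, steinWeight k u) (steinWeight k x) x := by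
    have h1 : ∀ x, ∫ u in Iic x, steinWeight k u
        = (∫ u in Iic 0, steinWeight k u) + ∫ u in (0 : ℝ)..x, steinWeight k u := fun x => by
      rw [← intervalIntegral.integral_Iic_sub_Iic hi.integrableOn hi.integrableOn]
      ring
    rw [funext h1]
    exact ((continuous_steinWeight hk).integral_hasStrictDerivAt 0 x).hasDerivAt.const_add _
  refine ((hasDerivAt_exp_sq x).mul hG).congr_deriv ?_
  have he : rexp (x ^ 2 / 2) * rexp (-x ^ 2 / 2) = 1 := by
    rw [← Real.exp_add]; simp [neg_div]
  rw [steinSolution, steinWeight]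
  linear_combination (k x - ∫ y, k y ∂(gaussianReal 0 1)) * he

/-- The weight has total integral zero, so the solution is minus an integral over the right tail.
Hence `x` times it is `-μ` times a Gaussian average of `k - E[k]` over that tail, with `μ = x
e^{x²/2} ∫_x^∞ e^{-u²/2} du`, and `μ ≤ 1` by the Mills bound. -/
theorem mul_steinSolution_bounds_of_nonneg (hk : Continuous k)
    (h01 : ∀ u, k u ∈ Icc (0 : ℝ) 1) {x : ℝ} (hx : 0 ≤ x) :
    ∃ μ ∈ Icc (0 : ℝ) 1, ∀ α β : ℝ, (∀ u, x ≤ u → k u - ∫ y, k y ∂(gaussianReal 0 1) ∈ Icc α β) →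
      x * steinSolution k x ∈ Icc (-(β * μ)) (-(α * μ)) := by
  have hi := integrable_steinWeight hk h01
  set J := ∫ u in Ioi x, rexp (-u ^ 2 / 2) with hJ
  have he : rexp (x ^ 2 / 2) * rexp (-x ^ 2 / 2) = 1 := by
    rw [← Real.exp_add]; simp [neg_div]
  have hJ0 : 0 ≤ J := integral_nonneg fun u => (Real.exp_pos _).le
  have hep := Real.exp_pos (x ^ 2 / 2)
  refine ⟨x * rexp (x ^ 2 / 2) * J, ⟨by positivity, ?_⟩, fun α β h => ?_⟩
  · have := mul_le_mul_of_nonneg_left (mul_integral_Ioi_exp_neg_sq_le x) hep.le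
    rw [he] at this
    linarith
  · have hs : steinSolution k x = -(rexp (x ^ 2 / 2) * ∫ u in Ioi x, steinWeight k u) := by
      have h1 := intervalIntegral.integral_Iic_add_Ioi (b := x) (μ := volume)
        hi.integrableOn hi.integrableOn
      rw [integral_steinWeight hk h01] at h1
      rw [steinSolution, eq_neg_of_add_eq_zero_left h1]
      ring
    have hlo : α * J ≤ ∫ u in Ioi x, steinWeight k u := by
      rw [hJ, ← integral_const_mul]
      refine setIntegral_mono_on (integrable_exp_neg_sq.const_mul α).integrableOn
        hi.integrableOn measurableSet_Ioi fun u hu => ?_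
      exact mul_le_mul_of_nonneg_right (h u (le_of_lt hu)).1 (Real.exp_pos _).le
    have hhi : ∫ u in Ioi x, steinWeight k u ≤ β * J := by
      rw [hJ, ← integral_const_mul]
      refine setIntegral_mono_on hi.integrableOn (integrable_exp_neg_sq.const_mul β).integrableOn
        measurableSet_Ioi fun u hu => ?_
      exact mul_le_mul_of_nonneg_right (h u (le_of_lt hu)).2 (Real.exp_pos _).le
    have hxe : 0 ≤ x * rexp (x ^ 2 / 2) := by positivity
    have h3 := mul_le_mul_of_nonneg_left hlo hxe
    have h4 := mul_le_mul_of_nonneg_left hhi hxe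
    rw [hs]
    constructor <;> linarith

theorem mul_steinSolution_bounds_of_nonpos (hk : Continuous k)
    (h01 : ∀ u, k u ∈ Icc (0 : ℝ) 1) {x : ℝ} (hx : x ≤ 0) :
    ∃ μ ∈ Icc (0 : ℝ) 1, ∀ α β : ℝ, (∀ u, u ≤ x → k u - ∫ y, k y ∂(gaussianReal 0 1) ∈ Icc α β) →
      x * steinSolution k x ∈ Icc (-(β * μ)) (-(α * μ)) := by
  have hi := integrable_steinWeight hk h01
  set J := ∫ u in Iic x, rexp (-u ^ 2 / 2) with hJ
  have he : rexp (x ^ 2 / 2) * rexp (-x ^ 2 / 2) = 1 := by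
    rw [← Real.exp_add]; simp [neg_div]
  have hJ0 : 0 ≤ J := integral_nonneg fun u => (Real.exp_pos _).le
  have hep := Real.exp_pos (x ^ 2 / 2)
  have hxe : 0 ≤ -x * rexp (x ^ 2 / 2) := mul_nonneg (by linarith) hep.le
  refine ⟨-x * rexp (x ^ 2 / 2) * J, ⟨mul_nonneg hxe hJ0, ?_⟩, fun α β h => ?_⟩
  · have := mul_le_mul_of_nonneg_left (neg_mul_integral_Iic_exp_neg_sq_le x) hep.le
    rw [he] at this
    linarith
  · have hlo : α * J ≤ ∫ u in Iic x, steinWeight k u := by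
      rw [hJ, ← integral_const_mul]
      refine setIntegral_mono_on (integrable_exp_neg_sq.const_mul α).integrableOn
        hi.integrableOn measurableSet_Iic fun u hu => ?_
      exact mul_le_mul_of_nonneg_right (h u hu).1 (Real.exp_pos _).le
    have hhi : ∫ u in Iic x, steinWeight k u ≤ β * J := by
      rw [hJ, ← integral_const_mul]
      refine setIntegral_mono_on hi.integrableOn (integrable_exp_neg_sq.const_mul β).integrableOn
        measurableSet_Iic fun u hu => ?_
      exact mul_le_mul_of_nonneg_right (h u hu).2 (Real.exp_pos _).le
    have h3 := mul_le_mul_of_nonneg_left hlo hxe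
    have h4 := mul_le_mul_of_nonneg_left hhi hxe
    rw [steinSolution]
    constructor <;> linarith

theorem abs_deriv_steinSolution_le_two (hk : Continuous k) (h01 : ∀ u, k u ∈ Icc (0 : ℝ) 1)
    (x : ℝ) :
    |x * steinSolution k x + (k x - ∫ y, k y ∂(gaussianReal 0 1))| ≤ 2 := by
  have hc := integral_mem_Icc hk h01
  set c := ∫ y, k y ∂(gaussianReal 0 1)
  have hb : ∀ u, k u - c ∈ Icc (-1 : ℝ) 1 := fun u =>
    ⟨by linarith [(h01 u).1, hc.2], by linarith [(h01 u).2, hc.1]⟩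
  obtain ⟨μ, hμ, h⟩ : ∃ μ ∈ Icc (0 : ℝ) 1, x * steinSolution k x ∈
      Icc (-(1 * μ)) (-(-1 * μ)) := by
    rcases le_total 0 x with hx | hx
    · obtain ⟨μ, hμ, h⟩ := mul_steinSolution_bounds_of_nonneg hk h01 hx
      exact ⟨μ, hμ, h _ _ fun u _ => hb u⟩
    · obtain ⟨μ, hμ, h⟩ := mul_steinSolution_bounds_of_nonpos hk h01 hx
      exact ⟨μ, hμ, h _ _ fun u _ => hb u⟩
  rw [abs_le]
  constructor <;> linarith [h.1, h.2, hμ.1, hμ.2, (hb x).1, (hb x).2]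

/-- Monotonicity bounds the tail average by the value at `x`: with `c = E[k]`, for `x ≥ 0` the
derivative lies between `(1 - μ)(k x - c)` and `k x - c + μ c`, and similarly for `x ≤ 0`. This
halves the general bound and separates the Kolmogorov constant from the total variation one. -/
theorem abs_deriv_steinSolution_le_one (hk : Continuous k) (h01 : ∀ u, k u ∈ Icc (0 : ℝ) 1)
    (hanti : Antitone k) (x : ℝ) :
    |x * steinSolution k x + (k x - ∫ y, k y ∂(gaussianReal 0 1))| ≤ 1 := by
  have hc := integral_mem_Icc hk h01
  set c := ∫ y, k y ∂(gaussianReal 0 1)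
  have hx0 := (h01 x).1
  have hx1 := (h01 x).2
  rw [abs_le]
  rcases le_total 0 x with hx | hx
  · obtain ⟨μ, hμ, h⟩ := mul_steinSolution_bounds_of_nonneg hk h01 hx
    have h' := h (-c) (k x - c) fun u hu =>
      ⟨by linarith [(h01 u).1], by linarith [hanti hu]⟩
    constructor
    · nlinarith [h'.1, hμ.1, hμ.2, hc.1, hc.2]
    · nlinarith [h'.2, hμ.1, hμ.2, hc.1, hc.2]
  · obtain ⟨μ, hμ, h⟩ := mul_steinSolution_bounds_of_nonpos hk h01 hx
    have h' := h (k x - c) (1 - c) fun u hu =>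
      ⟨by linarith [hanti hu], by linarith [(h01 u).2]⟩
    constructor
    · nlinarith [h'.1, hμ.1, hμ.2, hc.1, hc.2]
    · nlinarith [h'.2, hμ.1, hμ.2, hc.1, hc.2]

/-! ### From the approximate Stein identity to distances -/

/-- The law `m` satisfies Stein's identity for the variance `σ²` up to the discrepancy `D`. -/
def SteinDiscrepancyLE (m : Measure ℝ) (σ D : ℝ) : Prop :=
  ∀ g : ℝ → ℝ, ContDiff ℝ 1 g → ∀ K : ℝ, (∀ x, |deriv g x| ≤ K) →
    |∫ x, (σ ^ 2 * deriv g x - x * g x) ∂m| ≤ K * D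

variable {m : Measure ℝ} [IsProbabilityMeasure m] {σ D : ℝ}

/-- The function `g (x / σ) / σ` turns the unit-variance Stein equation into the one for variance
`σ²`, and its derivative is `g' (x / σ) / σ²`. -/
theorem SteinDiscrepancyLE.abs_integral_sub_le (hD : SteinDiscrepancyLE m σ D) (hσ : 0 < σ)
    {h g g' : ℝ → ℝ} {c K : ℝ} (hh : Integrable h m) (hg : ∀ x, HasDerivAt g (g' x) x)
    (hg' : Continuous g') (hK : ∀ x, |g' x| ≤ K) (heq : ∀ y, g' y - y * g y = h (σ * y) - c) :
    |∫ x, h x ∂m - c| ≤ K / σ ^ 2 * D := by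
  have hs : ∀ x, HasDerivAt (fun x => g (x / σ) / σ) (g' (x / σ) / σ ^ 2) x := fun x => by
    have h1 : HasDerivAt (fun x : ℝ => x / σ) (1 / σ) x := (hasDerivAt_id x).div_const σ
    have h2 : HasDerivAt (fun x => g (x / σ)) (g' (x / σ) * (1 / σ)) x :=
      HasDerivAt.comp (h₂ := g) (h := fun x => x / σ) x (hg (x / σ)) h1
    refine (h2.div_const σ).congr_deriv ?_
    field_simp
  have hder : deriv (fun x => g (x / σ) / σ) = fun x => g' (x / σ) / σ ^ 2 :=
    funext fun x => (hs x).deriv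
  have hC : ContDiff ℝ 1 fun x => g (x / σ) / σ := by
    rw [contDiff_one_iff_deriv]
    exact ⟨fun x => (hs x).differentiableAt, by rw [hder]; fun_prop⟩
  have hmain := hD _ hC (K / σ ^ 2) fun x => by
    rw [hder, abs_div, abs_of_pos (by positivity : 0 < σ ^ 2)]
    exact div_le_div_of_nonneg_right (hK _) (by positivity)
  have hpt : ∀ x, σ ^ 2 * deriv (fun x => g (x / σ) / σ) x - x * (g (x / σ) / σ) = h x - c :=
    fun x => by
    have := heq (x / σ)
    rw [mul_div_cancel₀ _ hσ.ne'] at this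
    rw [hder, ← this]
    field_simp
  simp_rw [hpt] at hmain
  rwa [integral_sub hh (integrable_const c), integral_const, probReal_univ, one_smul] at hmain

theorem map_mul_gaussianReal (σ : ℝ) :
    (gaussianReal 0 1).map (σ * ·) = gaussianReal 0 (Real.toNNReal (σ ^ 2)) := by
  rw [gaussianReal_map_const_mul]
  congr 1
  · simp
  · ext
    simp [Real.coe_toNNReal _ (sq_nonneg σ)]

theorem integral_gaussianReal_scale (σ : ℝ) {h : ℝ → ℝ} (hh : Continuous h) :
    ∫ y, h (σ * y) ∂(gaussianReal 0 1) = ∫ y, h y ∂(gaussianReal 0 (Real.toNNReal (σ ^ 2))) := by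
  rw [← map_mul_gaussianReal σ, integral_map (by fun_prop) hh.aestronglyMeasurable]

theorem SteinDiscrepancyLE.abs_integral_sub_le_of_bound (hD : SteinDiscrepancyLE m σ D)
    (hσ : 0 < σ) {h : ℝ → ℝ} {K : ℝ} (hh : Continuous h) (h01 : ∀ u, h u ∈ Icc (0 : ℝ) 1)
    (hK : ∀ x, |x * steinSolution (fun y => h (σ * y)) x
      + (h (σ * x) - ∫ y, h (σ * y) ∂(gaussianReal 0 1))| ≤ K) :
    |∫ x, h x ∂m - ∫ x, h x ∂(gaussianReal 0 (Real.toNNReal (σ ^ 2)))| ≤ K / σ ^ 2 * D := by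
  have hkc : Continuous fun y => h (σ * y) := by fun_prop
  have hd := hasDerivAt_steinSolution hkc fun u => h01 (σ * u)
  rw [← integral_gaussianReal_scale σ hh]
  refine hD.abs_integral_sub_le hσ (integrable_of_mem_Icc hh h01) hd ?_ hK fun y => by ring
  have hcs : Continuous (steinSolution fun y => h (σ * y)) :=
    continuous_iff_continuousAt.2 fun x => (hd x).continuousAt
  fun_prop

/-- Continuous test functions with values in `[0, 1]`. -/
theorem SteinDiscrepancyLE.abs_integral_sub_le_of_continuous (hD : SteinDiscrepancyLE m σ D)
    (hσ : 0 < σ) {h : ℝ → ℝ} (hh : Continuous h) (h01 : ∀ u, h u ∈ Icc (0 : ℝ) 1) :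
    |∫ x, h x ∂m - ∫ x, h x ∂(gaussianReal 0 (Real.toNNReal (σ ^ 2)))| ≤ 2 / σ ^ 2 * D :=
  hD.abs_integral_sub_le_of_bound hσ hh h01
    (abs_deriv_steinSolution_le_two (by fun_prop) fun u => h01 (σ * u))

/-- Decreasing continuous test functions with values in `[0, 1]`. -/
theorem SteinDiscrepancyLE.abs_integral_sub_le_of_antitone (hD : SteinDiscrepancyLE m σ D)
    (hσ : 0 < σ) {h : ℝ → ℝ} (hh : Continuous h) (h01 : ∀ u, h u ∈ Icc (0 : ℝ) 1)
    (ha : Antitone h) :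
    |∫ x, h x ∂m - ∫ x, h x ∂(gaussianReal 0 (Real.toNNReal (σ ^ 2)))| ≤ 1 / σ ^ 2 * D :=
  hD.abs_integral_sub_le_of_bound hσ hh h01
    (abs_deriv_steinSolution_le_one (by fun_prop) (fun u => h01 (σ * u))
      fun _ _ huv => ha (mul_le_mul_of_nonneg_left huv hσ.le))

/-! ### Borel sets and half-lines by approximation. -/

theorem SteinDiscrepancyLE.abs_measureReal_sub_le (hD : SteinDiscrepancyLE m σ D) (hσ : 0 < σ)
    {B : Set ℝ} (hB : MeasurableSet B) :
    |m.real B - (gaussianReal 0 (Real.toNNReal (σ ^ 2))).real B| ≤ 2 / σ ^ 2 * D := by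
  set n := gaussianReal 0 (Real.toNNReal (σ ^ 2)) with hn
  refine le_of_forall_pos_le_add fun ε hε => ?_
  -- Approximating in `L¹(m + n)` gives one test function that works for both laws; clipping it to
  -- `[0, 1]` does not increase its distance to the indicator.
  have hind : Integrable (B.indicator fun _ => (1 : ℝ)) (m + n) :=
    (integrable_const 1).indicator hB
  obtain ⟨g, hg, hgi⟩ := hind.exists_boundedContinuous_integral_sub_le hε
  set h : ℝ → ℝ := fun x => max 0 (min 1 (g x)) with hh
  have hhc : Continuous h := by fun_prop
  have h01 : ∀ u, h u ∈ Icc (0 : ℝ) 1 := fun u =>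
    ⟨le_max_left _ _, max_le zero_le_one (min_le_left _ _)⟩
  have hclip : ∀ x, ‖B.indicator (fun _ => (1 : ℝ)) x - h x‖
      ≤ ‖B.indicator (fun _ => (1 : ℝ)) x - g x‖ := fun x => by
    simp only [hh, Real.norm_eq_abs]
    by_cases hx : x ∈ B
    · simp only [indicator_of_mem hx]
      rcases le_total 1 (g x) with h1 | h1
      · simp [min_eq_left h1]
      · rw [min_eq_right h1, abs_of_nonneg (by simpa using h1), abs_of_nonneg (by linarith)]
        linarith [le_max_right 0 (g x)]
    · simp only [indicator_of_notMem hx, zero_sub, abs_neg]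
      rcases le_total 0 (g x) with h1 | h1
      · rw [abs_of_nonneg h1, abs_of_nonneg (le_max_left _ _)]
        exact max_le h1 (min_le_right _ _)
      · rw [max_eq_left ((min_le_right _ _).trans h1)]
        simp
  have him : Integrable (B.indicator fun _ => (1 : ℝ)) m := (integrable_const 1).indicator hB
  have hin : Integrable (B.indicator fun _ => (1 : ℝ)) n := (integrable_const 1).indicator hB
  have hhm : Integrable h m := integrable_of_mem_Icc hhc h01
  have hhn : Integrable h n := integrable_of_mem_Icc hhc h01
  have hsum : ∫ x, ‖B.indicator (fun _ => (1 : ℝ)) x - h x‖ ∂m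
      + ∫ x, ‖B.indicator (fun _ => (1 : ℝ)) x - h x‖ ∂n ≤ ε := by
    rw [← integral_add_measure (f := fun x => ‖B.indicator (fun _ => (1 : ℝ)) x - h x‖)
      (him.sub hhm).norm (hin.sub hhn).norm]
    refine (integral_mono ?_ (hind.sub hgi).norm hclip).trans hg
    exact (hind.sub (integrable_of_mem_Icc hhc h01)).norm
  have em : ∫ x, B.indicator (fun _ => (1 : ℝ)) x ∂m = m.real B := by
    rw [integral_indicator_const _ hB]; simp
  have en : ∫ x, B.indicator (fun _ => (1 : ℝ)) x ∂n = n.real B := by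
    rw [integral_indicator_const _ hB]; simp
  have k1 : |m.real B - ∫ x, h x ∂m| ≤ ∫ x, ‖B.indicator (fun _ => (1 : ℝ)) x - h x‖ ∂m := by
    rw [← em, ← integral_sub him hhm, ← Real.norm_eq_abs]
    exact norm_integral_le_integral_norm _
  have k2 : |n.real B - ∫ x, h x ∂n| ≤ ∫ x, ‖B.indicator (fun _ => (1 : ℝ)) x - h x‖ ∂n := by
    rw [← en, ← integral_sub hin hhn, ← Real.norm_eq_abs]
    exact norm_integral_le_integral_norm _
  have k3 := hD.abs_integral_sub_le_of_continuous hσ hhc h01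
  rw [abs_le] at k1 k2 k3 ⊢
  constructor <;> linarith [k1.1, k1.2, k2.1, k2.2, k3.1, k3.2]

/-- The ramps equal `1` up to `z` and are continuous and decreasing, so the sharper bound for
antitone test functions survives in the limit. -/
theorem tendsto_integral_ramp (n : Measure ℝ) [IsFiniteMeasure n] (z : ℝ) :
    Tendsto (fun N : ℕ => ∫ x, max 0 (min 1 (1 - N * (x - z))) ∂n) atTop
      (𝓝 (n.real (Iic z))) := by
  have e : n.real (Iic z) = ∫ x, (Iic z).indicator (fun _ => (1 : ℝ)) x ∂n := by
    rw [integral_indicator_const _ measurableSet_Iic]; simp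
  rw [e]
  refine tendsto_integral_of_dominated_convergence (fun _ => 1)
    (fun N => Continuous.aestronglyMeasurable (by fun_prop)) (integrable_const 1)
    (fun N => ae_of_all _ fun x => ?_) (ae_of_all _ fun x => ?_)
  · rw [Real.norm_eq_abs, abs_of_nonneg (le_max_left _ _)]
    exact max_le zero_le_one (min_le_left _ _)
  · by_cases hx : x ≤ z
    · rw [indicator_of_mem (by exact hx)]
      refine tendsto_const_nhds.congr fun N => ?_
      have : (N : ℝ) * (x - z) ≤ 0 := mul_nonpos_of_nonneg_of_nonpos N.cast_nonneg (by linarith)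
      rw [min_eq_left (by linarith), max_eq_right zero_le_one]
    · rw [indicator_of_notMem (by exact hx)]
      have hxz : 0 < x - z := by linarith [not_le.1 hx]
      refine tendsto_const_nhds.congr' ?_
      obtain ⟨N₀, hN₀⟩ := exists_nat_ge (1 / (x - z))
      filter_upwards [eventually_ge_atTop N₀] with N hN
      have h1 : 1 ≤ (N : ℝ) * (x - z) := by
        rw [← div_le_iff₀ hxz]
        exact hN₀.trans (by exact_mod_cast hN)
      rw [max_eq_left ((min_le_right _ _).trans (by linarith))]

theorem SteinDiscrepancyLE.abs_measureReal_Iic_sub_le (hD : SteinDiscrepancyLE m σ D)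
    (hσ : 0 < σ) (z : ℝ) :
    |m.real (Iic z) - (gaussianReal 0 (Real.toNNReal (σ ^ 2))).real (Iic z)| ≤ 1 / σ ^ 2 * D := by
  refine le_of_tendsto ((tendsto_integral_ramp m z).sub (tendsto_integral_ramp _ z)).abs
    (Eventually.of_forall fun N => ?_)
  refine hD.abs_integral_sub_le_of_antitone hσ (by fun_prop) (fun u =>
    ⟨le_max_left _ _, max_le zero_le_one (min_le_left _ _)⟩) fun u v huv => ?_
  gcongr

end

section

/-! ### Stein's equation with Lipschitz test functions -/

theorem integrable_id_gaussianReal : Integrable (fun y : ℝ => y) (gaussianReal 0 1) :=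
  (memLp_id_gaussianReal 1).integrable (by simp)

theorem integral_abs_gaussianReal : ∫ y, |y| ∂(gaussianReal 0 1) = √(2 / π) := by
  rw [integral_gaussianReal_eq_integral_smul one_ne_zero]
  have h1 : ∀ y : ℝ, gaussianPDFReal 0 1 y • |y|
      = (√(2 * π))⁻¹ * (|y| * rexp (-|y| ^ 2 / 2)) := fun y => by
    simp [gaussianPDFReal]
    ring
  simp_rw [h1]
  rw [integral_const_mul, integral_comp_abs (f := fun y => y * rexp (-y ^ 2 / 2)),
    integral_Ioi_mul_exp_neg_sq]
  rw [Real.sqrt_div two_pos.le, Real.sqrt_mul two_pos.le]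
  have h2 : √2 * √2 = 2 := Real.mul_self_sqrt two_pos.le
  have h3 : √2 ≠ 0 := by positivity
  have h4 : √π ≠ 0 := by positivity
  simp
  field_simp
  linarith

/-- The measure `dθ ⊗ N(0, 1)` on `(0, π / 2] × ℝ`. -/
noncomputable def angleGaussian : Measure (ℝ × ℝ) :=
  (volume.restrict (Ioc 0 (π / 2))).prod (gaussianReal 0 1)

instance isFiniteMeasure_angleGaussian : IsFiniteMeasure angleGaussian := by
  unfold angleGaussian; infer_instance

/-- The solution of Stein's equation given by the Ornstein-Uhlenbeck semigroup, in terms of the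
derivative of the test function. -/
noncomputable def mehlerSolution (k' : ℝ → ℝ) (x : ℝ) : ℝ :=
  -∫ q, Real.sin q.1 * k' (Real.cos q.1 * x + Real.sin q.1 * q.2) ∂angleGaussian

variable {k k' k'' : ℝ → ℝ} {L B : ℝ}

theorem norm_mul_le_of_abs_le_one {s t M : ℝ} (hs : |s| ≤ 1) (ht : |t| ≤ M) : ‖s * t‖ ≤ M := by
  rw [norm_mul, Real.norm_eq_abs, Real.norm_eq_abs]
  nlinarith [abs_nonneg s, abs_nonneg t]

theorem hasDerivAt_mehlerSolution (hk' : ∀ x, HasDerivAt k' (k'' x) x) (hk'' : Continuous k'')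
    (hL : ∀ x, |k' x| ≤ L) (hB : ∀ x, |k'' x| ≤ B) (x : ℝ) :
    HasDerivAt (mehlerSolution k') (-∫ q, Real.sin q.1 * (Real.cos q.1 *
      k'' (Real.cos q.1 * x + Real.sin q.1 * q.2)) ∂angleGaussian) x := by
  have hc : Continuous k' := continuous_iff_continuousAt.2 fun x => (hk' x).continuousAt
  have hF := hasDerivAt_integral_of_dominated_loc_of_deriv_le (μ := angleGaussian)
    (bound := fun _ => B) (x₀ := x)
    (F := fun x q => Real.sin q.1 * k' (Real.cos q.1 * x + Real.sin q.1 * q.2))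
    (F' := fun x q => Real.sin q.1 * (Real.cos q.1 *
      k'' (Real.cos q.1 * x + Real.sin q.1 * q.2))) (s := univ) univ_mem
    (Eventually.of_forall fun x => Continuous.aestronglyMeasurable (by fun_prop))
    (Integrable.of_bound (Continuous.aestronglyMeasurable (by fun_prop)) L
      (ae_of_all _ fun q => norm_mul_le_of_abs_le_one (Real.abs_sin_le_one _) (hL _)))
    (Continuous.aestronglyMeasurable (by fun_prop))
    (ae_of_all _ fun q x _ => norm_mul_le_of_abs_le_one (Real.abs_sin_le_one _)
      (norm_mul_le_of_abs_le_one (Real.abs_cos_le_one _) (hB _)))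
    (integrable_const B) (ae_of_all _ fun q x _ => by
      have h1 : HasDerivAt (fun x => Real.cos q.1 * x + Real.sin q.1 * q.2) (Real.cos q.1) x := by
        simpa using ((hasDerivAt_id x).const_mul (Real.cos q.1)).add_const (Real.sin q.1 * q.2)
      have h2 := HasDerivAt.comp (h₂ := k')
        (h := fun x => Real.cos q.1 * x + Real.sin q.1 * q.2) x (hk' _) h1
      exact (h2.const_mul (Real.sin q.1)).congr_deriv (by ring))
  exact hF.2.neg

theorem continuous_deriv_mehlerSolution (hk'' : Continuous k'') (hB : ∀ x, |k'' x| ≤ B) :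
    Continuous fun x => -∫ q, Real.sin q.1 * (Real.cos q.1 *
      k'' (Real.cos q.1 * x + Real.sin q.1 * q.2)) ∂angleGaussian := by
  refine (continuous_of_dominated (bound := fun _ => B)
    (fun x => Continuous.aestronglyMeasurable (by fun_prop)) (fun x => ae_of_all _ fun q => ?_)
    (integrable_const B) (ae_of_all _ fun q => by fun_prop)).neg
  exact norm_mul_le_of_abs_le_one (Real.abs_sin_le_one _)
    (norm_mul_le_of_abs_le_one (Real.abs_cos_le_one _) (hB _))

theorem integrable_mul_bounded (hc : Continuous k') (hL : ∀ x, |k' x| ≤ L) (x θ : ℝ) :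
    Integrable (fun y => y * k' (Real.cos θ * x + Real.sin θ * y)) (gaussianReal 0 1) :=
  integrable_id_gaussianReal.mul_bdd (c := L) (Continuous.aestronglyMeasurable (by fun_prop))
    (ae_of_all _ fun y => hL _)

/-- Integration by parts in `y` trades `k''` for a factor `y`, so that estimates depend on `L` and
not on `B`. -/
theorem integral_sin_mul_deriv (hk' : ∀ x, HasDerivAt k' (k'' x) x) (hk'' : Continuous k'')
    (hL : ∀ x, |k' x| ≤ L) (hB : ∀ x, |k'' x| ≤ B) (x θ : ℝ) :
    ∫ y, Real.sin θ * (Real.cos θ * k'' (Real.cos θ * x + Real.sin θ * y)) ∂(gaussianReal 0 1)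
      = ∫ y, Real.cos θ * (y * k' (Real.cos θ * x + Real.sin θ * y)) ∂(gaussianReal 0 1) := by
  have hc : Continuous k' := continuous_iff_continuousAt.2 fun x => (hk' x).continuousAt
  have hd : ∀ y, HasDerivAt (fun y => k' (Real.cos θ * x + Real.sin θ * y))
      (Real.sin θ * k'' (Real.cos θ * x + Real.sin θ * y)) y := fun y => by
    have h1 : HasDerivAt (fun y => Real.cos θ * x + Real.sin θ * y) (Real.sin θ) y := by
      simpa using ((hasDerivAt_id y).const_mul (Real.sin θ)).const_add (Real.cos θ * x)
    exact (HasDerivAt.comp (h₂ := k')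
      (h := fun y => Real.cos θ * x + Real.sin θ * y) y (hk' _) h1).congr_deriv (by ring)
  rw [integral_const_mul (Real.cos θ), integral_mul_gaussianReal_eq_integral_deriv hd
    (Integrable.of_bound (Continuous.aestronglyMeasurable (by fun_prop)) L
      (ae_of_all _ fun y => hL _))
    (integrable_mul_bounded hc hL x θ)
    (Integrable.of_bound (Continuous.aestronglyMeasurable (by fun_prop)) B
      (ae_of_all _ fun y => norm_mul_le_of_abs_le_one (Real.abs_sin_le_one _) (hB _))),
    ← integral_const_mul]
  exact integral_congr_ae (ae_of_all _ fun y => by ring)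

theorem integrable_deriv_mehlerSolution (hk'' : Continuous k'') (hB : ∀ x, |k'' x| ≤ B) (x : ℝ) :
    Integrable (fun q : ℝ × ℝ => Real.sin q.1 * (Real.cos q.1 *
      k'' (Real.cos q.1 * x + Real.sin q.1 * q.2))) angleGaussian :=
  Integrable.of_bound (Continuous.aestronglyMeasurable (by fun_prop)) B
    (ae_of_all _ fun q => norm_mul_le_of_abs_le_one (Real.abs_sin_le_one _)
      (norm_mul_le_of_abs_le_one (Real.abs_cos_le_one _) (hB _)))

/-- After the integration by parts, the bound is `L` times `E|Y| = √(2/π)` times the integral of the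
cosine, which is `1`. -/
theorem abs_deriv_mehlerSolution_le (hk' : ∀ x, HasDerivAt k' (k'' x) x) (hk'' : Continuous k'')
    (hL : ∀ x, |k' x| ≤ L) (hB : ∀ x, |k'' x| ≤ B) (x : ℝ) :
    |-∫ q, Real.sin q.1 * (Real.cos q.1 *
      k'' (Real.cos q.1 * x + Real.sin q.1 * q.2)) ∂angleGaussian| ≤ L * √(2 / π) := by
  have hL0 : 0 ≤ L := (abs_nonneg _).trans (hL 0)
  have hi := integrable_deriv_mehlerSolution hk'' hB x
  rw [angleGaussian] at hi ⊢
  rw [abs_neg, integral_prod _ hi, ← Real.norm_eq_abs]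
  have hcos : ∫ θ in Ioc 0 (π / 2), Real.cos θ * (L * √(2 / π)) = L * √(2 / π) := by
    rw [integral_mul_const, ← intervalIntegral.integral_of_le (by positivity), integral_cos]
    simp
  rw [← hcos]
  refine norm_integral_le_of_norm_le ?_ ?_
  · exact ((continuous_cos.integrableOn_Icc (a := 0) (b := π / 2)).mono_set
      Ioc_subset_Icc_self).mul_const _
  · filter_upwards [ae_restrict_mem measurableSet_Ioc] with θ hθ
    have hcθ : 0 ≤ Real.cos θ := Real.cos_nonneg_of_mem_Icc
      ⟨by linarith [hθ.1, Real.pi_pos], hθ.2⟩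
    rw [integral_sin_mul_deriv hk' hk'' hL hB x θ, integral_const_mul, norm_mul,
      Real.norm_of_nonneg hcθ]
    refine mul_le_mul_of_nonneg_left ?_ hcθ
    rw [← integral_abs_gaussianReal, ← integral_const_mul]
    refine norm_integral_le_of_norm_le (integrable_id_gaussianReal.abs.const_mul L)
      (ae_of_all _ fun y => ?_)
    rw [norm_mul, mul_comm, Real.norm_eq_abs, Real.norm_eq_abs]
    exact mul_le_mul_of_nonneg_right (hL _) (abs_nonneg y)

theorem integrable_of_deriv_bounded {m : Measure ℝ} [IsFiniteMeasure m]
    (hm : Integrable (fun y : ℝ => y) m)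
    (hk : ∀ x, HasDerivAt k (k' x) x) (hL : ∀ x, |k' x| ≤ L) : Integrable k m := by
  have hc : Continuous k := continuous_iff_continuousAt.2 fun x => (hk x).continuousAt
  refine ((integrable_const |k 0|).add (hm.abs.const_mul L)).mono' hc.aestronglyMeasurable
    (ae_of_all _ fun x => ?_)
  have h1 := Convex.norm_image_sub_le_of_norm_hasDerivWithin_le (f := k) (f' := k') (s := univ)
    (x := 0) (y := x) (C := L) (fun x _ => (hk x).hasDerivWithinAt) (fun x _ => hL x) convex_univ
    (mem_univ _) (mem_univ _)
  have h2 := norm_le_norm_add_norm_sub' (k x) (k 0)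
  simp only [Real.norm_eq_abs, sub_zero, Pi.add_apply] at h1 h2 ⊢
  linarith

/-- Once `k''` is integrated away, the left side is minus the integral of the angular derivative of
`k (cos θ x + sin θ y)`, which runs from `k x` to `k y`. -/
theorem mehlerSolution_stein (hk : ∀ x, HasDerivAt k (k' x) x)
    (hk' : ∀ x, HasDerivAt k' (k'' x) x) (hk'' : Continuous k'')
    (hL : ∀ x, |k' x| ≤ L) (hB : ∀ x, |k'' x| ≤ B) (x : ℝ) :
    (-∫ q, Real.sin q.1 * (Real.cos q.1 *
      k'' (Real.cos q.1 * x + Real.sin q.1 * q.2)) ∂angleGaussian) - x * mehlerSolution k' x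
      = k x - ∫ y, k y ∂(gaussianReal 0 1) := by
  have hc : Continuous k' := continuous_iff_continuousAt.2 fun x => (hk' x).continuousAt
  have hi := integrable_deriv_mehlerSolution hk'' hB x
  have hI1 : Integrable (fun q : ℝ × ℝ => Real.cos q.1 *
      (q.2 * k' (Real.cos q.1 * x + Real.sin q.1 * q.2))) angleGaussian := by
    have hq : Integrable (fun q : ℝ × ℝ => q.2) angleGaussian :=
      integrable_id_gaussianReal.comp_snd _
    exact (hq.mul_bdd (c := L) (Continuous.aestronglyMeasurable (by fun_prop))
      (ae_of_all _ fun y => hL _)).bdd_mul (c := 1) (Continuous.aestronglyMeasurable (by fun_prop))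
      (ae_of_all _ fun q => Real.abs_cos_le_one _)
  have hI2 : Integrable (fun q : ℝ × ℝ => Real.sin q.1 *
      k' (Real.cos q.1 * x + Real.sin q.1 * q.2)) angleGaussian :=
    Integrable.of_bound (Continuous.aestronglyMeasurable (by fun_prop)) L
      (ae_of_all _ fun q => norm_mul_le_of_abs_le_one (Real.abs_sin_le_one _) (hL _))
  have e1 : ∫ q, Real.sin q.1 * (Real.cos q.1 *
      k'' (Real.cos q.1 * x + Real.sin q.1 * q.2)) ∂angleGaussian
      = ∫ q, Real.cos q.1 * (q.2 * k' (Real.cos q.1 * x + Real.sin q.1 * q.2))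
        ∂angleGaussian := by
    rw [angleGaussian] at hi hI1 ⊢
    rw [integral_prod _ hi, integral_prod _ hI1]
    exact integral_congr_ae (ae_of_all _ fun θ => integral_sin_mul_deriv hk' hk'' hL hB x θ)
  have e2 : ∫ q, (Real.cos q.1 * (q.2 * k' (Real.cos q.1 * x + Real.sin q.1 * q.2))
      - x * (Real.sin q.1 * k' (Real.cos q.1 * x + Real.sin q.1 * q.2))) ∂angleGaussian
      = ∫ y, (k y - k x) ∂(gaussianReal 0 1) := by
    have hI3 : Integrable (fun q : ℝ × ℝ => Real.cos q.1 *
        (q.2 * k' (Real.cos q.1 * x + Real.sin q.1 * q.2))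
        - x * (Real.sin q.1 * k' (Real.cos q.1 * x + Real.sin q.1 * q.2))) angleGaussian :=
      hI1.sub (hI2.const_mul x)
    rw [angleGaussian] at hI3 ⊢
    rw [integral_prod_symm _ hI3]
    refine integral_congr_ae (ae_of_all _ fun y => ?_)
    have hd : ∀ θ : ℝ, HasDerivAt (fun θ => k (Real.cos θ * x + Real.sin θ * y))
        (Real.cos θ * (y * k' (Real.cos θ * x + Real.sin θ * y))
          - x * (Real.sin θ * k' (Real.cos θ * x + Real.sin θ * y))) θ := fun θ => by
      have h1 : HasDerivAt (fun θ => Real.cos θ * x + Real.sin θ * y)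
          (-Real.sin θ * x + Real.cos θ * y) θ :=
        ((Real.hasDerivAt_cos θ).mul_const x).add ((Real.hasDerivAt_sin θ).mul_const y)
      exact (HasDerivAt.comp (h₂ := k) (h := fun θ => Real.cos θ * x + Real.sin θ * y) θ
        (hk _) h1).congr_deriv (by ring)
    have := intervalIntegral.integral_eq_sub_of_hasDerivAt (a := 0) (b := π / 2)
      (fun θ _ => hd θ) (Continuous.intervalIntegrable (by fun_prop) _ _)
    rw [intervalIntegral.integral_of_le (by positivity)] at this
    simpa using this
  rw [integral_sub hI1 (hI2.const_mul x), integral_const_mul,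
    integral_sub (integrable_of_deriv_bounded integrable_id_gaussianReal hk hL)
      (integrable_const _)] at e2
  rw [e1, mehlerSolution]
  simp only [integral_const, probReal_univ, one_smul] at e2
  linarith

/-! ### Mollification of Lipschitz functions -/

/-- No sign is imposed on `ψ`, so the estimate serves both for the mollifier, bounding `k'`, and for
its derivative, bounding `k''`. -/
theorem lipschitzWith_convolution {ψ h : ℝ → ℝ} (hψ : Continuous ψ) (hψc : HasCompactSupport ψ)
    (hh : LipschitzWith 1 h) (x y : ℝ) :
    ‖(∫ t, ψ t * h (x - t)) - ∫ t, ψ t * h (y - t)‖ ≤ (∫ t, |ψ t|) * ‖x - y‖ := by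
  have hi : ∀ x, Integrable fun t => ψ t * h (x - t) := fun x =>
    Continuous.integrable_of_hasCompactSupport
      (hψ.mul (hh.continuous.comp (by fun_prop))) hψc.mul_right
  rw [← integral_sub (hi x) (hi y), ← integral_mul_const]
  refine norm_integral_le_of_norm_le
    ((hψ.integrable_of_hasCompactSupport hψc).abs.mul_const _) (ae_of_all _ fun t => ?_)
  rw [← mul_sub, norm_mul, Real.norm_eq_abs]
  refine mul_le_mul_of_nonneg_left ?_ (abs_nonneg _)
  simpa [dist_eq_norm] using hh.dist_le_mul (x - t) (y - t)

theorem abs_deriv_le_of_lipschitz {k : ℝ → ℝ} {C : ℝ} (hC : 0 ≤ C)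
    (hk : ∀ x y, ‖k x - k y‖ ≤ C * ‖x - y‖) (x : ℝ) : |deriv k x| ≤ C := by
  have h : LipschitzWith C.toNNReal k := LipschitzWith.of_dist_le_mul fun x y => by
    rw [Real.coe_toNNReal _ hC, dist_eq_norm, dist_eq_norm]
    exact hk x y
  have := norm_deriv_le_of_lipschitz (x₀ := x) h
  rwa [Real.coe_toNNReal _ hC] at this

/-- Convolution with a normalized bump of radius `ε`. The bound `B` may blow up as `ε` shrinks; it
only justifies differentiation and integrability, and does not enter the final constant. -/
theorem exists_smooth_approx {h : ℝ → ℝ} (hh : LipschitzWith 1 h) {ε : ℝ} (hε : 0 < ε) :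
    ∃ (k k' k'' : ℝ → ℝ) (B : ℝ), (∀ x, HasDerivAt k (k' x) x) ∧ (∀ x, HasDerivAt k' (k'' x) x) ∧
      Continuous k'' ∧ (∀ x, |k' x| ≤ 1) ∧ (∀ x, |k'' x| ≤ B) ∧ ∀ x, |k x - h x| ≤ ε := by
  let φ : ContDiffBump (0 : ℝ) := ⟨ε / 2, ε, by positivity, by linarith⟩
  set ψ : ℝ → ℝ := φ.normed volume with hψ
  have hψs : ContDiff ℝ 2 ψ := φ.contDiff_normed
  have hψc : HasCompactSupport ψ := φ.hasCompactSupport_normed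
  have hloc : LocallyIntegrable h := hh.continuous.locallyIntegrable
  set k : ℝ → ℝ := fun x => ∫ t, ψ t * h (x - t) with hk
  set k' : ℝ → ℝ := fun x => ∫ t, deriv ψ t * h (x - t) with hk'
  have hconv : k = convolution ψ h (ContinuousLinearMap.lsmul ℝ ℝ) volume := by
    ext x; simp [hk, convolution]
  have hψ' : ContDiff ℝ 1 (deriv ψ) := ((contDiff_succ_iff_deriv (n := 1)).1 (by
    simpa [one_add_one_eq_two] using hψs)).2.2
  have hd1 : ∀ x, HasDerivAt k (k' x) x := fun x => by
    rw [hconv]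
    have := hψc.hasDerivAt_convolution_left (ContinuousLinearMap.lsmul ℝ ℝ)
      (hψs.of_le one_le_two) hloc x
    simpa [convolution, hk'] using this
  have hψc' : HasCompactSupport (deriv ψ) := hψc.deriv
  have hconv' : k' = convolution (deriv ψ) h (ContinuousLinearMap.lsmul ℝ ℝ) volume := by
    ext x; simp [hk', convolution]
  have hC1 : ContDiff ℝ 1 k' := by
    rw [hconv']
    exact hψc'.contDiff_convolution_left (n := 1) (ContinuousLinearMap.lsmul ℝ ℝ) hψ' hloc
  have hint : ∫ t, |ψ t| = 1 := by
    simp only [hψ, abs_of_nonneg (φ.nonneg_normed _)]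
    exact φ.integral_normed
  refine ⟨k, k', deriv k', ∫ t, |deriv ψ t|, hd1,
    fun x => (hC1.differentiable one_ne_zero x).hasDerivAt, hC1.continuous_deriv le_rfl,
    fun x => ?_, fun x => ?_, fun x => ?_⟩
  · rw [← (hd1 x).deriv]
    refine abs_deriv_le_of_lipschitz zero_le_one (fun x y => ?_) x
    rw [← hint]
    exact lipschitzWith_convolution hψs.continuous hψc hh x y
  · exact abs_deriv_le_of_lipschitz (integral_nonneg fun t => abs_nonneg _)
      (fun x y => lipschitzWith_convolution hψ'.continuous hψc' hh x y) x
  · rw [hconv, ← Real.dist_eq]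
    refine φ.dist_normed_convolution_le hh.continuous.aestronglyMeasurable fun y hy => ?_
    have h1 := hh.dist_le_mul y x
    have h2 : dist y x < ε := hy
    simp only [NNReal.coe_one, one_mul] at h1
    linarith

theorem SteinDiscrepancyLE.abs_integral_sub_le_of_lipschitz {m : Measure ℝ}
    [IsProbabilityMeasure m] {σ D : ℝ} (hD : SteinDiscrepancyLE m σ D) (hσ : 0 < σ)
    (hm : Integrable (fun y : ℝ => y) m) {h : ℝ → ℝ} (hh : LipschitzWith 1 h) :
    |∫ x, h x ∂m - ∫ x, h x ∂(gaussianReal 0 (Real.toNNReal (σ ^ 2)))|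
      ≤ σ * √(2 / π) / σ ^ 2 * D := by
  set n := gaussianReal 0 (Real.toNNReal (σ ^ 2)) with hn
  have hnid : Integrable (fun y : ℝ => y) n := (memLp_id_gaussianReal 1).integrable (by simp)
  refine le_of_forall_pos_le_add fun ε hε => ?_
  obtain ⟨k, k', k'', B, hk, hk', hk'', hL, hB, happ⟩ := exists_smooth_approx hh (half_pos hε)
  have hkc : Continuous k := continuous_iff_continuousAt.2 fun x => (hk x).continuousAt
  have hdil : ∀ {f f' : ℝ → ℝ}, (∀ x, HasDerivAt f (f' x) x) → ∀ x,
      HasDerivAt (fun x => f (σ * x)) (σ * f' (σ * x)) x := fun {f f'} hf x => by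
    have h1 : HasDerivAt (fun x => σ * x) σ x := by simpa using (hasDerivAt_id x).const_mul σ
    exact (HasDerivAt.comp (h₂ := f) (h := fun x => σ * x) x (hf _) h1).congr_deriv (by ring)
  -- The Stein equation is solved for the dilated function `k (σ x)`, whose derivative is bounded by
  -- `σ`; this is the factor `σ` in the numerator.
  have a1 := hdil hk
  have a2 : ∀ x, HasDerivAt (fun x => σ * k' (σ * x)) (σ * (σ * k'' (σ * x))) x := fun x =>
    (hdil hk' x).const_mul σ
  have a3 : Continuous fun x => σ * (σ * k'' (σ * x)) := by fun_prop
  have a4 : ∀ x, |σ * k' (σ * x)| ≤ σ := fun x => by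
    rw [abs_mul, abs_of_pos hσ]; nlinarith [hL (σ * x)]
  have a5 : ∀ x, |σ * (σ * k'' (σ * x))| ≤ σ * (σ * B) := fun x => by
    rw [abs_mul, abs_mul, abs_of_pos hσ]
    gcongr
    exact hB _
  have hkm : Integrable k m := integrable_of_deriv_bounded hm hk hL
  have hkn : Integrable k n := integrable_of_deriv_bounded hnid hk hL
  have key := hD.abs_integral_sub_le hσ (h := k) (c := ∫ y, k (σ * y) ∂(gaussianReal 0 1)) hkm
    (hasDerivAt_mehlerSolution a2 a3 a4 a5) (continuous_deriv_mehlerSolution a3 a5)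
    (abs_deriv_mehlerSolution_le a2 a3 a4 a5) (mehlerSolution_stein a1 a2 a3 a4 a5)
  rw [integral_gaussianReal_scale σ hkc, ← hn] at key
  have hclose : ∀ (l : Measure ℝ) [IsProbabilityMeasure l], Integrable k l →
      |∫ x, k x ∂l - ∫ x, h x ∂l| ≤ ε / 2 := fun l _ hkl => by
    have hdl : Integrable (fun x => k x - h x) l :=
      Integrable.of_bound (hkc.sub hh.continuous).aestronglyMeasurable (ε / 2)
        (ae_of_all _ happ)
    have hhl : Integrable h l := by
      have := hkl.sub hdl
      refine this.congr (ae_of_all _ fun x => ?_)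
      simp
    rw [← integral_sub hkl hhl, ← Real.norm_eq_abs]
    have := norm_integral_le_of_norm_le_const (μ := l) (f := fun x => k x - h x)
      (ae_of_all _ happ)
    simpa using this
  have c1 := hclose m hkm
  have c2 := hclose n hkn
  rw [abs_le] at key c1 c2 ⊢
  constructor <;> linarith [key.1, key.2, c1.1, c1.2, c2.1, c2.2]

end

end GaussianPoincare

/-! ### Transfer to the law of `X` and the three distances. -/

theorem mainTheorem2 {Ω Ω' : Type*} [MeasurableSpace Ω] [MeasurableSpace Ω']
    (P : Measure Ω) [IsProbabilityMeasure P] (P' : Measure Ω') [IsProbabilityMeasure P']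
    (d : ℕ) (X : Ω → EuclideanSpace ℝ (Fin d))
    (hX : HasLaw X (stdGaussian (EuclideanSpace ℝ (Fin d))) P)
    (f : EuclideanSpace ℝ (Fin d) → ℝ) (hf : ContDiff ℝ 2 f)
    (σ : ℝ) (hσ : 0 < σ)
    (hL2 : MemLp (fun ω => f (X ω)) 2 P)
    (hmean : ∫ ω, f (X ω) ∂P = 0)
    (hvar : ∫ ω, f (X ω) ^ 2 ∂P = σ ^ 2)
    (N : Ω' → ℝ) (hN : HasLaw N (gaussianReal 0 (Real.toNNReal (σ ^ 2))) P') :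
    GaussianPoincare.dTV P P' (fun ω => f (X ω)) N
        ≤ ENNReal.ofReal (4 / σ ^ 2) * GaussianPoincare.secondOrderQuantity P X f ∧
      GaussianPoincare.dKol P P' (fun ω => f (X ω)) N
        ≤ ENNReal.ofReal (2 / σ ^ 2) * GaussianPoincare.secondOrderQuantity P X f ∧
      GaussianPoincare.dW P P' (fun ω => f (X ω)) N
        ≤ ENNReal.ofReal (Real.sqrt (8 / (σ ^ 2 * Real.pi)))
          * GaussianPoincare.secondOrderQuantity P X f := by
  set γ := stdGaussian (EuclideanSpace ℝ (Fin d)) with hγ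
  have hQ : GaussianPoincare.secondOrderQuantity P X f
      = GaussianPoincare.hessianGradientSum f ^ (1 / 2 : ℝ) := by
    rw [GaussianPoincare.secondOrderQuantity, GaussianPoincare.hessianGradientSum]
    congr 1
    refine Finset.sum_congr rfl fun i _ => Finset.sum_congr rfl fun l _ => ?_
    have hcH := fun i j => (GaussianPoincare.continuous_hessianEntry hf i j).measurable
    have hcp := fun i => (GaussianPoincare.contDiff_partialDeriv hf i).continuous.measurable
    rw [hX.lintegral_comp (f := fun x => ENNReal.ofReal ((∑ j : Fin d,
        GaussianPoincare.hessianEntry i j f x * GaussianPoincare.hessianEntry l j f x) ^ 2))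
        ((Finset.measurable_sum _ fun j _ => (hcH i j).mul (hcH l j)).pow_const
          2).ennreal_ofReal.aemeasurable,
      hX.lintegral_comp (f := fun x => ENNReal.ofReal
        ((GaussianPoincare.partialDeriv i f x * GaussianPoincare.partialDeriv l f x) ^ 2))
        (((hcp i).mul (hcp l)).pow_const 2).ennreal_ofReal.aemeasurable]
  have c1 : 0 < 4 / σ ^ 2 := by positivity
  have c2 : 0 < 2 / σ ^ 2 := by positivity
  have c3 : 0 < Real.sqrt (8 / (σ ^ 2 * Real.pi)) := by positivity
  rw [hQ]
  -- Positivity of the constants makes the right-hand sides infinite here, despite `0 * ∞ = 0`.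
  by_cases hA : GaussianPoincare.hessianGradientSum f = ∞
  · rw [hA, ENNReal.top_rpow_of_pos (by norm_num)]
    rw [ENNReal.mul_top (by simpa using c1), ENNReal.mul_top (by simpa using c2),
      ENNReal.mul_top (by simpa using c3)]
    exact ⟨le_top, le_top, le_top⟩
  set S := GaussianPoincare.hessianGradientSum f ^ (1 / 2 : ℝ) with hS
  have hSfin : S ≠ ∞ := ENNReal.rpow_ne_top_of_nonneg (by norm_num) hA
  have hfc : Continuous f := hf.continuous
  set m := γ.map f with hm
  have hmprob : IsProbabilityMeasure m := Measure.isProbabilityMeasure_map hfc.aemeasurable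
  have hlaw : HasLaw (fun ω => f (X ω)) m P :=
    HasLaw.comp (Y := f) ⟨hfc.aemeasurable, rfl⟩ hX
  have hL2γ : MemLp f 2 γ := by
    rw [← hX.map_eq]
    exact (memLp_map_measure_iff hfc.aestronglyMeasurable hX.aemeasurable).2 hL2
  have hmeanγ : ∫ x, f x ∂γ = 0 := by
    rw [← hX.integral_comp hfc.aestronglyMeasurable, ← hmean]; rfl
  have hvarγ : ∫ x, f x ^ 2 ∂γ = σ ^ 2 := by
    rw [← hX.integral_comp (f := fun x => f x ^ 2) (hfc.pow 2).aestronglyMeasurable, ← hvar]; rfl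
  have hD : GaussianPoincare.SteinDiscrepancyLE m σ (2 * S.toReal) := fun g hg K hK => by
    rw [hm, integral_map hfc.aemeasurable]
    · exact GaussianPoincare.abs_integral_stein_le hf hA hL2γ hmeanγ hvarγ hg hK
    · exact ((continuous_const.mul (hg.continuous_deriv le_rfl)).sub
        (continuous_id.mul hg.continuous)).aestronglyMeasurable
  have hto : ∀ {a c : ℝ}, 0 ≤ c → a ≤ c * S.toReal → ENNReal.ofReal a ≤ ENNReal.ofReal c * S :=
    fun {a c} hc h => by
    rw [← ENNReal.ofReal_toReal hSfin, ← ENNReal.ofReal_mul hc]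
    exact ENNReal.ofReal_le_ofReal h
  refine ⟨iSup₂_le fun B hB => hto c1.le ?_, iSup_le fun z => hto c2.le ?_,
    iSup₂_le fun h hh => hto c3.le ?_⟩
  · rw [hlaw.measureReal_eq (p := (· ∈ B)) hB, hN.measureReal_eq (p := (· ∈ B)) hB]
    exact (hD.abs_measureReal_sub_le hσ hB).trans (le_of_eq (by ring))
  · rw [hlaw.measureReal_eq (p := (· ≤ z)) measurableSet_Iic,
      hN.measureReal_eq (p := (· ≤ z)) measurableSet_Iic]
    exact (hD.abs_measureReal_Iic_sub_le hσ z).trans (le_of_eq (by ring))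
  · have hmid : Integrable (fun y : ℝ => y) m :=
      (integrable_map_measure (by fun_prop) hfc.aemeasurable).2 (hL2γ.integrable one_le_two)
    have hi1 := hlaw.integral_comp (f := h) hh.continuous.aestronglyMeasurable
    have hi2 := hN.integral_comp (f := h) hh.continuous.aestronglyMeasurable
    simp only [Function.comp_def] at hi1 hi2
    rw [hi1, hi2]
    refine (hD.abs_integral_sub_le_of_lipschitz hσ hmid hh).trans (le_of_eq ?_)
    -- The `2` on the right is the factor of the discrepancy `2 * S.toReal`, and `1 / σ` is what
    -- remains of `σ / σ²`.
    have hsq : Real.sqrt (8 / (σ ^ 2 * Real.pi)) = 2 * Real.sqrt (2 / Real.pi) / σ := by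
      rw [show 8 / (σ ^ 2 * Real.pi) = (2 / σ) ^ 2 * (2 / Real.pi) by field_simp; norm_num,
        Real.sqrt_mul (by positivity), Real.sqrt_sq (by positivity)]
      ring
    rw [hsq]
    field_simp
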